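/- All graphs are finite, simple and undirected. A graph $G$ is called $k$-connected ($k\ge 1$) if $|V(G)|>k$ and $G-T$ is connected for every $T\subseteq V(G)$ with $|T|<k$; the connectivity $\kappa(G)$ is the largest $k$ such that $G$ is $k$-connected. A smallest separating set of $G$ is a set $T\subseteq V(G)$ with $|T|=\kappa(G)$ such that $G-T$ is disconnected. For such a $T$, a $T$-fragment is the union of the vertex sets of at least one but not of all components of $G-T$. A fragment is a $T$-fragment for some smallest separating set $T$; for a set $\mathfrak S$ of subsets of $V(G)$, an $\mathfrak S$-fragment is a $T$-fragment for some smallest separating set $T$ such that $S\subseteq T$ for some $S\in\mathfrak S$. An edge $e$ of a $k$-connected graph $G$ is $k$-contractible if the graph $G/e$, obtained by identifying the endvertices of $e$ and simplifying the result, is $k$-connected. A DFS tree of $G$ is a spanning tree $Q$ of $G$ with a prescribed root vertex $r$ such that, for every vertex $x$, any two distinct $x$-branches are nonadjacent in $G$ (that is, no edge of $G$ joins them), where an $x$-branch is the vertex set of a component of $Q-x$ not containing $r$. Theorem. Let $Q$ be a DFS tree of a noncomplete graph $G$ of connectivity $k>3$, and set $\mathfrak S:=\{V(e) : e\in E(Q)\}$,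 where $V(e)$ is the set of the two endvertices of $e$. (i) If every $\mathfrak S$-fragment has cardinality at least $\frac{k-1}{2}$, then $Q$ contains at least one $k$-contractible edge. (ii) If every fragment has cardinality at least $\frac{k-1}{2}$, then $Q$ contains at least two $k$-contractible edges. -/

import Mathlib

namespace SimpleGraph

variable {V : Type*}

/-- `G` is `k`-connected: it has more than `k` vertices, and `G - T` is connected for every
vertex set `T` with fewer than `k` elements. (For finite graphs and `k ≥ 1`.) -/
def IsKConnected (G : SimpleGraph V) (k : ℕ) : Prop :=
  k < Nat.card V ∧ ∀ T : Set V, T.ncard < k → (G.induce Tᶜ).Connected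

/-- The connectivity `κ(G)`: the largest `k` such that `G` is `k`-connected
(the set is bounded by the number of vertices; the value is `0` if `G` is not connected). -/
noncomputable def connectivity (G : SimpleGraph V) : ℕ :=
  sSup {k : ℕ | G.IsKConnected k}

/-- `T` is a smallest separating set of `G`: `|T| = κ(G)` and `G - T` is disconnected. -/
def IsSmallestSeparating (G : SimpleGraph V) (T : Set V) : Prop :=
  T.ncard = G.connectivity ∧ ¬ (G.induce Tᶜ).Connected

/-- `F` is a `T`-fragment: `T` is a smallest separating set, and `F` is the union of the vertex
sets of at least one but not of all components of `G - T`. -/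
def IsFragmentOf (G : SimpleGraph V) (T F : Set V) : Prop :=
  G.IsSmallestSeparating T ∧
    ∃ C : Set (G.induce Tᶜ).ConnectedComponent,
      C.Nonempty ∧ C ≠ Set.univ ∧ F = Subtype.val '' (⋃ c ∈ C, c.supp)

/-- `F` is a fragment, that is, a `T`-fragment for some smallest separating set `T`. -/
def IsFragment (G : SimpleGraph V) (F : Set V) : Prop :=
  ∃ T : Set V, G.IsFragmentOf T F

/-- For a family `𝔖` of vertex sets, `F` is an `𝔖`-fragment if it is a `T`-fragment for some
smallest separating set `T` that contains a member of `𝔖`. -/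
def IsFragmentWrt (G : SimpleGraph V) (𝔖 : Set (Set V)) (F : Set V) : Prop :=
  ∃ T : Set V, G.IsFragmentOf T F ∧ ∃ S ∈ 𝔖, S ⊆ T

/-- The family `{V(e) : e ∈ E(Q)}` of the sets of endvertices of the edges of `Q`. -/
def edgeVertexSets (Q : SimpleGraph V) : Set (Set V) :=
  (fun e : Sym2 V => {v | v ∈ e}) '' Q.edgeSet

/-- The equivalence relation on vertices that identifies the two endvertices of `e`. -/
def identifyEnds (e : Sym2 V) : Setoid V where
  r a b := a = b ∨ (a ∈ e ∧ b ∈ e)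
  iseqv :=
    { refl := fun _ => Or.inl rfl
      symm := by
        rintro a b (h | h)
        · exact Or.inl h.symm
        · exact Or.inr ⟨h.2, h.1⟩
      trans := by
        rintro a b c (rfl | h) (rfl | h')
        · exact Or.inl rfl
        · exact Or.inr h'
        · exact Or.inr h
        · exact Or.inr ⟨h.1, h'.2⟩ }

/-- The graph `G/e`: the endvertices of `e` are identified and the result is simplified
(loops and multiple edges disappear). -/
def contractEdge (G : SimpleGraph V) (e : Sym2 V) :
    SimpleGraph (Quotient (identifyEnds e)) where
  Adj p q := p ≠ q ∧ ∃ a b : V,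
    Quotient.mk (identifyEnds e) a = p ∧ Quotient.mk (identifyEnds e) b = q ∧ G.Adj a b
  symm := ⟨fun _ _ h => ⟨h.1.symm, by
    obtain ⟨_, a, b, ha, hb, hab⟩ := h
    exact ⟨b, a, hb, ha, hab.symm⟩⟩⟩
  loopless := ⟨fun _ h => h.1 rfl⟩

/-- The edge `e` of `G` is `k`-contractible: `G/e` is `k`-connected. -/
def IsKContractible (G : SimpleGraph V) (k : ℕ) (e : Sym2 V) : Prop :=
  e ∈ G.edgeSet ∧ (G.contractEdge e).IsKConnected k

/-- `B` is an `x`-branch of the tree `Q` with root `r`: the vertex set of a component of `Q - x`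
that does not contain `r`. -/
def IsBranch (Q : SimpleGraph V) (r x : V) (B : Set V) : Prop :=
  r ∉ B ∧ ∃ c : (Q.induce {x}ᶜ).ConnectedComponent, B = Subtype.val '' c.supp

/-- `Q` is a depth-first search tree of `G` with root `r`: a spanning tree of `G` such that, for
every vertex `x`, no edge of `G` joins two distinct `x`-branches. -/
def IsDFSTree (G Q : SimpleGraph V) (r : V) : Prop :=
  Q ≤ G ∧ Q.IsTree ∧
    ∀ (x : V) (B B' : Set V), Q.IsBranch r x B → Q.IsBranch r x B' → B ≠ B' →
      ∀ u ∈ B, ∀ v ∈ B', ¬ G.Adj u v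

end SimpleGraph

set_option linter.unusedSectionVars false

/-! Suppose that no edge of `Q` is contractible, except possibly one with both ends in a clique `W`:
`W` is empty for (i) and consists of the ends of the only contractible edge for (ii). A
noncontractible edge lies in a smallest separating set. Put m = ⌊k/2⌋. The relevant fragments have
at least m vertices while k ≤ 2m + 1, so two crossing separations leave almost no freedom for the
sizes of their nine cells.

Let E be an end, i.e. an inclusion-minimal fragment, with separator T, and let T' be a separator
through a tree edge ab leaving E at b. Minimality and counting force E ⊆ T', |E| = m, k = 2m + 1 and
T ∩ T' = {b} (`end_crossing`). From this, all such edges leaving E share their outer end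
(`exit_unique`). So an end avoiding `W` hangs in the tree on a single vertex b, and the DFS property
puts T, apart from b, into one component K of Q - b (`exists_main_part`). If a separator through ab
contains m vertices X outside E ∪ {b}, it equals E ∪ {b} ∪ X. Now K meets both of its sides and
avoids E and b, so tree edges leave X to both sides and X cannot hang on a single vertex
(`not_exitsTo`).

Descending to smaller fragments yields two anchored ends A₁, A₂ and a third end A₃ such that A₁ ∪
{b₁} ∪ A₃ is a separator (`exists_isTriad`). In (i), A₃ also hangs on a single vertex, a
contradiction. In (ii), the tree edges leaving A₃ end in b₂ or are the exceptional edge, and both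
kinds must occur. Comparing the components K₁ and K₂ then contradicts the DFS property, or, if the
root lies in A₂, the location of T₁ (`not_pair`). -/

namespace SimpleGraph

/-! ### Crossing separations and the sizes of their cells -/

section Separations

variable {V : Type*} [DecidableEq V] {G : SimpleGraph V} {k : ℕ}
  {F T R F' T' R' : Finset V}

/-- `T` is a set of `k` vertices that separates the nonempty sides `F` and `R`. -/
structure IsSeparation (G : SimpleGraph V) (k : ℕ) (F T R : Finset V) : Prop where
  nonempty_left : F.Nonempty
  nonempty_right : R.Nonempty
  card_mid : T.card = k
  cover : ∀ v, v ∈ F ∨ v ∈ T ∨ v ∈ R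
  left_mid : ∀ v ∈ F, v ∉ T
  left_right : ∀ v ∈ F, v ∉ R
  mid_right : ∀ v ∈ T, v ∉ R
  not_adj : ∀ u ∈ F, ∀ v ∈ R, ¬ G.Adj u v

/-- Every set that separates a nonempty vertex set from some further vertex has at least `k`
elements. -/
def SeparatorBound (G : SimpleGraph V) (k : ℕ) : Prop :=
  ∀ A S : Finset V, A.Nonempty → (∃ v, v ∉ A ∧ v ∉ S) →
    (∀ u ∈ A, ∀ v, G.Adj u v → v ∈ A ∨ v ∈ S) → k ≤ S.card

namespace IsSeparation

theorem symm (h : IsSeparation G k F T R) : IsSeparation G k R T F where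
  nonempty_left := h.nonempty_right
  nonempty_right := h.nonempty_left
  card_mid := h.card_mid
  cover v := by have := h.cover v; tauto
  left_mid v hv hT := h.mid_right v hT hv
  left_right v hv hF := h.left_right v hF hv
  mid_right v hv hF := h.left_mid v hF hv
  not_adj u hu v hv huv := h.not_adj v hv u hu huv.symm

theorem adj_left (h : IsSeparation G k F T R) {u v : V} (hu : u ∈ F) (huv : G.Adj u v) :
    v ∈ F ∨ v ∈ T := by
  have := h.cover v
  have := h.not_adj u hu v
  tauto

theorem card_inter (h : IsSeparation G k F T R) (X : Finset V) :
    X.card = (X ∩ F).card + (X ∩ T).card + (X ∩ R).card := by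
  rw [← Finset.card_union_of_disjoint, ← Finset.card_union_of_disjoint]
  · congr 1
    ext v
    have := h.cover v
    simp only [Finset.mem_union, Finset.mem_inter]
    tauto
  · rw [Finset.disjoint_left]
    intro v
    have := h.left_right v
    have := h.mid_right v
    simp only [Finset.mem_union, Finset.mem_inter]
    tauto
  · rw [Finset.disjoint_left]
    intro v
    have := h.left_mid v
    simp only [Finset.mem_inter]
    tauto

theorem card_inter' (h : IsSeparation G k F T R) (X : Finset V) :
    X.card = (F ∩ X).card + (T ∩ X).card + (R ∩ X).card := by
  rw [Finset.inter_comm F, Finset.inter_comm T, Finset.inter_comm R]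
  exact h.card_inter X

/-- The sizes of the nine cells of two separations. -/
theorem card_cells (h : IsSeparation G k F T R) (h' : IsSeparation G k F' T' R') :
    F.card = (F ∩ F').card + (F ∩ T').card + (F ∩ R').card ∧
    k = (T ∩ F').card + (T ∩ T').card + (T ∩ R').card ∧
    R.card = (R ∩ F').card + (R ∩ T').card + (R ∩ R').card ∧
    F'.card = (F ∩ F').card + (T ∩ F').card + (R ∩ F').card ∧
    k = (F ∩ T').card + (T ∩ T').card + (R ∩ T').card ∧
    R'.card = (F ∩ R').card + (T ∩ R').card + (R ∩ R').card :=
  ⟨h'.card_inter F, h.card_mid ▸ h'.card_inter T, h'.card_inter R, h.card_inter' F',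
    h'.card_mid ▸ h.card_inter' T', h.card_inter' R'⟩

theorem card_corner (h : IsSeparation G k F T R) (h' : IsSeparation G k F' T' R') :
    (F ∩ T' ∪ T ∩ T' ∪ T ∩ F').card = (F ∩ T').card + (T ∩ T').card + (T ∩ F').card := by
  rw [Finset.card_union_of_disjoint, Finset.card_union_of_disjoint]
  · rw [Finset.disjoint_left]
    intro v
    have := h.left_mid v
    simp only [Finset.mem_inter]
    tauto
  · rw [Finset.disjoint_left]
    intro v
    have := h.left_mid v
    have := h'.left_mid v
    simp only [Finset.mem_union, Finset.mem_inter]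
    tauto

theorem corner_adj (h : IsSeparation G k F T R) (h' : IsSeparation G k F' T' R') {u v : V}
    (hu : u ∈ F ∩ F') (huv : G.Adj u v) : v ∈ F ∩ F' ∨ v ∈ F ∩ T' ∪ T ∩ T' ∪ T ∩ F' := by
  rw [Finset.mem_inter] at hu
  have h1 := h.adj_left hu.1 huv
  have h2 := h'.adj_left hu.2 huv
  simp only [Finset.mem_union, Finset.mem_inter]
  tauto

/-- The corner set contains all outside neighbours of the cell. By `card_cells` the corner sets of
opposite cells have total size 2k: if both cells are nonempty, both corner sets have exactly k
elements, and a corner set larger than k forces the opposite cell to be empty. -/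
theorem le_corner (h : IsSeparation G k F T R) (h' : IsSeparation G k F' T' R')
    (hk : G.SeparatorBound k) (hne : (F ∩ F').Nonempty) :
    k ≤ (F ∩ T').card + (T ∩ T').card + (T ∩ F').card := by
  rw [← h.card_corner h']
  refine hk (F ∩ F') _ hne ?_ fun u hu v huv => h.corner_adj h' hu huv
  obtain ⟨v, hv⟩ := h.nonempty_right
  refine ⟨v, ?_⟩
  have h1 := h.left_right v
  have h2 := h.mid_right v
  simp only [Finset.mem_union, Finset.mem_inter]
  tauto

theorem corner (h : IsSeparation G k F T R) (h' : IsSeparation G k F' T' R')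
    (hne : (F ∩ F').Nonempty)
    (hc : (F ∩ T').card + (T ∩ T').card + (T ∩ F').card = k) :
    IsSeparation G k (F ∩ F') (F ∩ T' ∪ T ∩ T' ∪ T ∩ F') (R ∪ R') where
  nonempty_left := hne
  nonempty_right := h.nonempty_right.mono Finset.subset_union_left
  card_mid := by rw [h.card_corner h', hc]
  cover v := by
    have := h.cover v
    have := h'.cover v
    simp only [Finset.mem_union, Finset.mem_inter]
    tauto
  left_mid v := by
    have := h.left_mid v
    have := h'.left_mid v
    simp only [Finset.mem_union, Finset.mem_inter]
    tauto
  left_right v := by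
    have := h.left_right v
    have := h'.left_right v
    simp only [Finset.mem_union, Finset.mem_inter]
    tauto
  mid_right v := by
    have := h.left_right v
    have := h'.left_right v
    have := h.mid_right v
    have := h'.mid_right v
    simp only [Finset.mem_union, Finset.mem_inter]
    tauto
  not_adj u hu v hv huv := by
    rw [Finset.mem_inter] at hu
    have := h.not_adj u hu.1 v
    have := h'.not_adj u hu.2 v
    rw [Finset.mem_union] at hv
    tauto

/-- Every vertex of a separator of minimum size has a neighbour on each side. -/
theorem exists_adj (h : IsSeparation G k F T R) (hk : G.SeparatorBound k) {t : V} (ht : t ∈ T) :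
    ∃ a ∈ F, G.Adj a t := by
  by_contra! hcon
  have h1 := hk F (T.erase t) h.nonempty_left ?_ ?_
  · rw [Finset.card_erase_of_mem ht, h.card_mid] at h1
    have : 0 < T.card := Finset.card_pos.2 ⟨t, ht⟩
    have := h.card_mid
    omega
  · obtain ⟨v, hv⟩ := h.nonempty_right
    exact ⟨v, fun hF => h.left_right v hF hv, fun hT => h.mid_right v (Finset.mem_of_mem_erase hT) hv⟩
  · intro u hu v huv
    rcases h.adj_left hu huv with hv | hv
    · exact Or.inl hv
    · refine Or.inr (Finset.mem_erase.2 ⟨?_, hv⟩)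
      rintro rfl
      exact hcon u hu huv

end IsSeparation

/-- The setting for both parts of the theorem: `P` singles out the separators whose sides are known
to have at least `m` elements, and every edge of `Q` that is not contained in `W` lies in a smallest
separator. -/
structure TreeSetting (G Q : SimpleGraph V) (k m : ℕ) (P : Finset V → Prop) (W : Set V) :
    Prop where
  le : Q ≤ G
  bound : G.SeparatorBound k
  two_mul_le : 2 * m ≤ k
  le_two_mul : k ≤ 2 * m + 1
  two_le : 2 ≤ m
  le_card : ∀ {F T R}, G.IsSeparation k F T R → P T → m ≤ F.card
  of_edge : ∀ {F T R u v}, G.IsSeparation k F T R → Q.Adj u v → ¬ (u ∈ W ∧ v ∈ W) →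
    u ∈ T → v ∈ T → P T
  exists_sep : ∀ {u v}, Q.Adj u v → ¬ (u ∈ W ∧ v ∈ W) →
    ∃ F T R, G.IsSeparation k F T R ∧ u ∈ T ∧ v ∈ T
  clique : ∀ u ∈ W, ∀ v ∈ W, u ≠ v → G.Adj u v

/-- An inclusion-minimal side of a separation from the family `P`. -/
structure IsEnd (G : SimpleGraph V) (k : ℕ) (P : Finset V → Prop) (F T R : Finset V) : Prop where
  sep : G.IsSeparation k F T R
  fam : P T
  minimal : ∀ {F' T' R'}, G.IsSeparation k F' T' R' → P T' → F' ⊆ F → F' = F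

variable {Q : SimpleGraph V} {m : ℕ} {P : Finset V → Prop} {W : Set V}

theorem IsSeparation.exists_isEnd (h : G.IsSeparation k F T R) (hP : P T) :
    ∃ E T' R', G.IsEnd k P E T' R' ∧ E ⊆ F := by
  induction hn : F.card using Nat.strong_induction_on generalizing F T R with
  | _ n ih =>
    by_cases hmin : ∀ F' T' R', G.IsSeparation k F' T' R' → P T' → F' ⊆ F → F' = F
    · exact ⟨F, T, R, ⟨h, hP, fun h1 h2 h3 => hmin _ _ _ h1 h2 h3⟩, subset_rfl⟩
    · push Not at hmin
      obtain ⟨F', T', R', h1, h2, h3, h4⟩ := hmin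
      obtain ⟨E, T'', R'', hE, hsub⟩ := ih F'.card
        (hn ▸ Finset.card_lt_card (h3.ssubset_of_ne h4)) h1 h2 rfl
      exact ⟨E, T'', R'', hE, hsub.trans h3⟩

variable {E : Finset V} {a b : V}

/-- A corner set of size k at a cell of E would again contain a and b, so that cell would be a
smaller fragment of the family. Hence a nonempty cell has a corner set larger than k. The opposite
cell is then empty, and the bound m on the sides makes T or T' too large. -/
theorem TreeSetting.inter_eq_empty (hS : TreeSetting G Q k m P W) (hE : G.IsEnd k P E T R)
    (h' : G.IsSeparation k F' T' R') (ha : a ∈ E) (hb : b ∈ T) (hab : Q.Adj a b)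
    (hW : ¬ (a ∈ W ∧ b ∈ W)) (ha' : a ∈ T') (hb' : b ∈ T') : E ∩ F' = ∅ := by
  by_contra hne
  rw [← Ne, ← Finset.nonempty_iff_ne_empty] at hne
  have key : ∀ {F' R'}, G.IsSeparation k F' T' R' → (E ∩ F').Nonempty →
      k + 1 ≤ (E ∩ T').card + (T ∩ T').card + (T ∩ F').card := by
    intro F' R' h' hne
    refine Nat.lt_of_le_of_ne (hE.sep.le_corner h' hS.bound hne) fun heq => ?_
    have hc := hE.sep.corner h' hne heq.symm
    have hP := hS.of_edge hc hab hW (by simp [ha, ha']) (by simp [hb, hb'])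
    have := hE.minimal hc hP Finset.inter_subset_left
    have haF : a ∈ E ∩ F' := by rw [this]; exact ha
    exact h'.left_mid a (Finset.mem_inter.1 haF).2 ha'
  have hP' := hS.of_edge h' hab hW ha' hb'
  have h1 := key h' hne
  have hcells := hE.sep.card_cells h'
  have hTT : 1 ≤ (T ∩ T').card := Finset.card_pos.2 ⟨b, by simp [hb, hb']⟩
  have hRR : (R ∩ R').card = 0 := by
    by_contra hc
    have := hE.sep.symm.le_corner h'.symm hS.bound (Finset.card_ne_zero.1 hc)
    omega
  have hF := hS.le_card h' hP'
  have hR := hS.le_card h'.symm hP'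
  have hER := hS.le_card hE.sep.symm hE.fam
  have := hS.le_two_mul
  by_cases hn : (E ∩ R').Nonempty
  · have h2 := key h'.symm hn
    have hRF : (R ∩ F').card = 0 := by
      by_contra hc
      have := hE.sep.symm.le_corner h' hS.bound (Finset.card_ne_zero.1 hc)
      omega
    omega
  · rw [Finset.not_nonempty_iff_eq_empty, ← Finset.card_eq_zero] at hn
    have hRF : (R ∩ F').card = 0 := by
      by_contra hc
      have := hE.sep.symm.le_corner h' hS.bound (Finset.card_ne_zero.1 hc)
      omega
    omega

/-- How an end lies with respect to a separator through a tree edge leaving it. -/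
theorem TreeSetting.end_crossing (hS : TreeSetting G Q k m P W) (hE : G.IsEnd k P E T R)
    (h' : G.IsSeparation k F' T' R') (ha : a ∈ E) (hb : b ∈ T) (hab : Q.Adj a b)
    (hW : ¬ (a ∈ W ∧ b ∈ W)) (ha' : a ∈ T') (hb' : b ∈ T') :
    E ⊆ T' ∧ E.card = m ∧ k = 2 * m + 1 ∧ (T ∩ F').card = m ∧ (T ∩ R').card = m ∧
      T ∩ T' = {b} := by
  have e1 := hS.inter_eq_empty hE h' ha hb hab hW ha' hb'
  have e2 := hS.inter_eq_empty hE h'.symm ha hb hab hW ha' hb'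
  have hsub : E ⊆ T' := by
    intro v hv
    have h1 : v ∉ E ∩ F' := by simp [e1]
    have h2 : v ∉ E ∩ R' := by simp [e2]
    have := h'.cover v
    simp only [Finset.mem_inter] at h1 h2
    tauto
  have hbm : b ∈ T ∩ T' := by simp [hb, hb']
  have hTT : 1 ≤ (T ∩ T').card := Finset.card_pos.2 ⟨b, hbm⟩
  have hP' := hS.of_edge h' hab hW ha' hb'
  have hcells := hE.sep.card_cells h'
  have hF := hS.le_card h' hP'
  have hR := hS.le_card h'.symm hP'
  have hEm := hS.le_card hE.sep hE.fam
  have hER := hS.le_card hE.sep.symm hE.fam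
  have hk := hS.le_two_mul
  rw [← Finset.card_eq_zero] at e1 e2
  -- Either alternative gives |T ∩ F'| ≥ m: an empty cell leaves F' ⊆ T, and the corner bound gives
  -- |T ∩ F'| ≥ |E|. The same holds for R', and b accounts for the remaining element of T.
  have c1 : (R ∩ F').card = 0 ∨ k ≤ (R ∩ T').card + (T ∩ T').card + (T ∩ F').card := by
    by_cases hc : (R ∩ F').Nonempty
    · exact Or.inr (hE.sep.symm.le_corner h' hS.bound hc)
    · exact Or.inl (by simpa [Finset.not_nonempty_iff_eq_empty] using hc)
  have c2 : (R ∩ R').card = 0 ∨ k ≤ (R ∩ T').card + (T ∩ T').card + (T ∩ R').card := by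
    by_cases hc : (R ∩ R').Nonempty
    · exact Or.inr (hE.sep.symm.le_corner h'.symm hS.bound hc)
    · exact Or.inl (by simpa [Finset.not_nonempty_iff_eq_empty] using hc)
  have hone : (T ∩ T').card = 1 := by omega
  refine ⟨hsub, by omega, by omega, by omega, by omega, ?_⟩
  obtain ⟨c, hc⟩ := Finset.card_eq_one.1 hone
  rw [hc] at hbm ⊢
  rw [Finset.mem_singleton.1 hbm]

end Separations

/-! ### Tree edges leaving an end -/

section Ends

variable {V : Type*} [DecidableEq V] {G Q : SimpleGraph V} {k m : ℕ}
  {P : Finset V → Prop} {W : Set V} {E T R F₁ T₁ R₁ F₂ T₂ R₂ : Finset V} {a b a' b' : V}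

theorem TreeSetting.not_two_exits_aux (hS : TreeSetting G Q k m P W) (hE : G.IsEnd k P E T R)
    (ha : a ∈ E) (hb : b ∈ T) (hab : Q.Adj a b) (hW : ¬ (a ∈ W ∧ b ∈ W))
    (ha' : a' ∈ E) (hb' : b' ∈ T) (hab' : Q.Adj a' b') (hW' : ¬ (a' ∈ W ∧ b' ∈ W))
    (h₁ : G.IsSeparation k F₁ T₁ R₁) (haT₁ : a ∈ T₁) (hbT₁ : b ∈ T₁)
    (h₂ : G.IsSeparation k F₂ T₂ R₂) (haT₂ : a' ∈ T₂) (hbT₂ : b' ∈ T₂)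
    (hbF₁ : b' ∈ F₁) (hbF₂ : b ∈ F₂) : False := by
  obtain ⟨hE₁, hEm, hk, hX₁, hY₁, hc₁⟩ := hS.end_crossing hE h₁ ha hb hab hW haT₁ hbT₁
  obtain ⟨hE₂, -, -, hX₂, hY₂, hc₂⟩ := hS.end_crossing hE h₂ ha' hb' hab' hW' haT₂ hbT₂
  have hm := hS.two_le
  have only₁ : ∀ v ∈ T, v ∈ T₁ → v = b := fun v hv hv' => by
    have : v ∈ T ∩ T₁ := Finset.mem_inter.2 ⟨hv, hv'⟩
    rwa [hc₁, Finset.mem_singleton] at this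
  have only₂ : ∀ v ∈ T, v ∈ T₂ → v = b' := fun v hv hv' => by
    have : v ∈ T ∩ T₂ := Finset.mem_inter.2 ⟨hv, hv'⟩
    rwa [hc₂, Finset.mem_singleton] at this
  have hXe₁ : ((T ∩ F₁).erase b').card = m - 1 := by
    rw [Finset.card_erase_of_mem (by simp [hb', hbF₁]), hX₁]
  have hXe₂ : ((T ∩ F₂).erase b).card = m - 1 := by
    rw [Finset.card_erase_of_mem (by simp [hb, hbF₂]), hX₂]
  have hRR : (R₁ ∩ R₂).Nonempty := by
    by_contra hne
    have hsub : T ∩ R₂ ⊆ (T ∩ F₁).erase b' := by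
      intro v hv
      rw [Finset.mem_inter] at hv
      rw [Finset.mem_erase, Finset.mem_inter]
      refine ⟨?_, hv.1, ?_⟩
      · rintro rfl
        exact h₂.mid_right _ hbT₂ hv.2
      · rcases h₁.cover v with h | h | h
        · exact h
        · rw [only₁ v hv.1 h] at hv
          exact absurd hv.2 (h₂.left_right b hbF₂)
        · exact absurd ⟨v, Finset.mem_inter.2 ⟨h, hv.2⟩⟩ hne
    have := Finset.card_le_card hsub
    omega
  have hcells := h₁.card_cells h₂
  have hRRc := h₁.symm.le_corner h₂.symm hS.bound hRR
  -- Otherwise the corner set at F₁ ∩ F₂ is a separator through ab that contains b' as well,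
  -- although it may meet T only in b.
  have hFF : ∀ v ∈ F₁, v ∉ F₂ := by
    intro v hv₁ hv₂
    have hne : (F₁ ∩ F₂).Nonempty := ⟨v, Finset.mem_inter.2 ⟨hv₁, hv₂⟩⟩
    have hle := h₁.le_corner h₂ hS.bound hne
    have hsep := h₁.corner h₂ hne (by omega)
    have := (hS.end_crossing hE hsep ha hb hab hW (by simp [haT₁, hE₂ ha])
      (by simp [hbT₁, hbF₂])).2.2.2.2.2
    have hb'mem : b' ∈ T ∩ (F₁ ∩ T₂ ∪ T₁ ∩ T₂ ∪ T₁ ∩ F₂) := by simp [hb', hbF₁, hbT₂]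
    rw [this, Finset.mem_singleton] at hb'mem
    exact h₁.left_mid b' hbF₁ (hb'mem ▸ hbT₁)
  obtain ⟨x, hx⟩ : ((T ∩ F₁).erase b').Nonempty := Finset.card_pos.1 (by omega)
  obtain ⟨x', hx'⟩ : ((T ∩ F₂).erase b).Nonempty := Finset.card_pos.1 (by omega)
  rw [Finset.mem_erase, Finset.mem_inter] at hx hx'
  have hxR : x ∈ R₂ := by
    have h1 := h₂.cover x
    have h2 := hFF x hx.2.2
    have h3 := only₂ x hx.2.1
    tauto
  have hxR' : x' ∈ R₁ := by
    have h1 := h₁.cover x'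
    have h2 := fun h => hFF x' h hx'.2.2
    have h3 := only₁ x' hx'.2.1
    tauto
  have hne : (F₁ ∩ R₂).Nonempty := ⟨x, Finset.mem_inter.2 ⟨hx.2.2, hxR⟩⟩
  have hle := h₁.le_corner h₂.symm hS.bound hne
  have hle' := h₁.symm.le_corner h₂ hS.bound ⟨x', Finset.mem_inter.2 ⟨hxR', hx'.2.2⟩⟩
  have hsep := h₁.corner h₂.symm hne (by omega)
  have hP := hS.of_edge hsep hab' hW' (by simp [hE₁ ha', haT₂]) (by simp [hbF₁, hbT₂])
  have hcard := hS.le_card hsep hP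
  have hET : E ⊆ F₁ ∩ T₂ ∪ T₁ ∩ T₂ ∪ T₁ ∩ R₂ := fun v hv => by simp [hE₁ hv, hE₂ hv]
  have hsmall : (F₁ ∩ R₂ ∩ T).card ≤ m - 1 := by
    rw [← hXe₁]
    refine Finset.card_le_card fun v hv => ?_
    simp only [Finset.mem_inter] at hv
    simp only [Finset.mem_erase, Finset.mem_inter]
    refine ⟨?_, hv.2, hv.1.1⟩
    rintro rfl
    exact h₂.mid_right v hbT₂ hv.1.2
  have hA : ((F₁ ∩ R₂) \ T).Nonempty := by
    rw [← Finset.card_pos]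
    have := Finset.card_sdiff_add_card_inter (F₁ ∩ R₂) T
    omega
  -- Vertices outside E ∪ T have no neighbour in E. So the m vertices of E in the corner separator
  -- can be replaced by the at most m - 1 vertices of F₁ ∩ R₂ ∩ T, leaving a separator of size below
  -- k.
  have hb := hS.bound ((F₁ ∩ R₂) \ T)
    (((F₁ ∩ T₂ ∪ T₁ ∩ T₂ ∪ T₁ ∩ R₂) \ E) ∪ (F₁ ∩ R₂ ∩ T)) hA ⟨a, ?_, ?_⟩ ?_
  · have h1 := Finset.card_union_le ((F₁ ∩ T₂ ∪ T₁ ∩ T₂ ∪ T₁ ∩ R₂) \ E) (F₁ ∩ R₂ ∩ T)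
    rw [Finset.card_sdiff_of_subset hET, hsep.card_mid, hEm] at h1
    omega
  · intro h
    simp only [Finset.mem_sdiff, Finset.mem_inter] at h
    exact h₁.left_mid a h.1.1 haT₁
  · intro h
    simp only [Finset.mem_union, Finset.mem_sdiff, Finset.mem_inter] at h
    rcases h with h | h
    · exact h.2 ha
    · exact hE.sep.left_mid a ha h.2
  · intro u hu v huv
    rw [Finset.mem_sdiff] at hu
    have hvE : v ∉ E := by
      intro hvE
      rcases hE.sep.adj_left hvE huv.symm with h | h
      · exact h₁.left_mid u (Finset.mem_inter.1 hu.1).1 (hE₁ h)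
      · exact hu.2 h
    have := h₁.corner_adj h₂.symm hu.1 huv
    by_cases hvT : v ∈ T
    · rcases this with h | h
      · exact Or.inr (Finset.mem_union_right _ (Finset.mem_inter.2 ⟨h, hvT⟩))
      · exact Or.inr (Finset.mem_union_left _ (Finset.mem_sdiff.2 ⟨h, hvE⟩))
    · rcases this with h | h
      · exact Or.inl (Finset.mem_sdiff.2 ⟨h, hvT⟩)
      · exact Or.inr (Finset.mem_union_left _ (Finset.mem_sdiff.2 ⟨h, hvE⟩))

/-- All tree edges leaving an end (except possibly one inside `W`) have the same outer endvertex. -/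
theorem TreeSetting.exit_unique (hS : TreeSetting G Q k m P W) (hE : G.IsEnd k P E T R)
    (ha : a ∈ E) (hb : b ∈ T) (hab : Q.Adj a b) (hW : ¬ (a ∈ W ∧ b ∈ W))
    (ha' : a' ∈ E) (hb' : b' ∈ T) (hab' : Q.Adj a' b') (hW' : ¬ (a' ∈ W ∧ b' ∈ W)) :
    b = b' := by
  by_contra hne
  obtain ⟨F₁, T₁, R₁, h₁, haT₁, hbT₁⟩ := hS.exists_sep hab hW
  obtain ⟨F₂, T₂, R₂, h₂, haT₂, hbT₂⟩ := hS.exists_sep hab' hW'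
  have hc₁ := (hS.end_crossing hE h₁ ha hb hab hW haT₁ hbT₁).2.2.2.2.2
  have hc₂ := (hS.end_crossing hE h₂ ha' hb' hab' hW' haT₂ hbT₂).2.2.2.2.2
  have hb₁ : b' ∉ T₁ := fun h => by
    have : b' ∈ T ∩ T₁ := Finset.mem_inter.2 ⟨hb', h⟩
    rw [hc₁, Finset.mem_singleton] at this
    exact hne this.symm
  have hb₂ : b ∉ T₂ := fun h => by
    have : b ∈ T ∩ T₂ := Finset.mem_inter.2 ⟨hb, h⟩
    rw [hc₂, Finset.mem_singleton] at this
    exact hne this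
  have aux := fun {F₁ R₁ F₂ R₂} h₁ h₂ => hS.not_two_exits_aux (F₁ := F₁) (R₁ := R₁) (F₂ := F₂)
    (R₂ := R₂) hE ha hb hab hW ha' hb' hab' hW' h₁ haT₁ hbT₁ h₂ haT₂ hbT₂
  rcases h₁.cover b' with h | h | h
  · rcases h₂.cover b with h' | h' | h'
    · exact aux h₁ h₂ h h'
    · exact hb₂ h'
    · exact aux h₁ h₂.symm h h'
  · exact hb₁ h
  · rcases h₂.cover b with h' | h' | h'
    · exact aux h₁.symm h₂ h h'
    · exact hb₂ h'
    · exact aux h₁.symm h₂.symm h h'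

end Ends

/-! ### Components of the tree minus a vertex -/

section Parts

variable {V : Type*} {G Q : SimpleGraph V} {r b : V} {K K' : Set V}

/-- `K` induces a connected subgraph of `Q`, expressed through cuts. -/
def CutConnected (Q : SimpleGraph V) (K : Set V) : Prop :=
  ∀ S : Set V, (∃ x ∈ K, x ∈ S) → (∃ y ∈ K, y ∉ S) → ∃ u ∈ K, u ∈ S ∧ ∃ v ∈ K, v ∉ S ∧ Q.Adj u v

/-- `K` is the vertex set of a component of `Q - b`. -/
structure IsPart (Q : SimpleGraph V) (b : V) (K : Set V) : Prop where
  nonempty : K.Nonempty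
  notMem : b ∉ K
  conn : Q.CutConnected K
  closed : ∀ u ∈ K, ∀ v, Q.Adj u v → v ∈ K ∨ v = b

/-- All edges of `Q` leaving `A` lead to `b`. -/
structure ExitsTo (Q : SimpleGraph V) (A : Set V) (b : V) : Prop where
  notMem : b ∉ A
  exit : ∀ u ∈ A, ∀ v, Q.Adj u v → v ∈ A ∨ v = b

theorem IsPart.exitsTo (h : Q.IsPart b K) : Q.ExitsTo K b := ⟨h.notMem, h.closed⟩

theorem CutConnected.subset {A : Set V} (hK : Q.CutConnected K) (hb : b ∉ K) (hA : Q.ExitsTo A b)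
    {x : V} (hx : x ∈ K) (hxA : x ∈ A) : K ⊆ A := by
  intro y hy
  by_contra hyA
  obtain ⟨u, hu, huA, v, hv, hvA, huv⟩ := hK A ⟨x, hx, hxA⟩ ⟨y, hy, hyA⟩
  rcases hA.exit u huA v huv with h | rfl
  · exact hvA h
  · exact hb hv

theorem IsPart.eq (h : Q.IsPart b K) (h' : Q.IsPart b K') {x : V} (hx : x ∈ K) (hx' : x ∈ K') :
    K = K' :=
  (h.conn.subset h.notMem h'.exitsTo hx hx').antisymm (h'.conn.subset h'.notMem h.exitsTo hx' hx)

/-- Removing a set all of whose edges to the rest lead to a single vertex keeps connectedness. -/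
theorem CutConnected.diff {A : Set V} {c : V} (hK : Q.CutConnected K)
    (hA : ∀ u ∈ K, u ∈ A → ∀ v ∈ K, v ∉ A → Q.Adj u v → v = c) : Q.CutConnected (K \ A) := by
  intro S hx hy
  obtain ⟨x, hx, hxS⟩ := hx
  obtain ⟨y, hy, hyS⟩ := hy
  by_cases hc : c ∈ S
  · obtain ⟨u, hu, huS, v, hv, hvS, huv⟩ := hK (S ∪ A) ⟨x, hx.1, Or.inl hxS⟩
      ⟨y, hy.1, by simp [hyS, hy.2]⟩
    have hvA : v ∉ A := fun h => hvS (Or.inr h)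
    have hvS' : v ∉ S := fun h => hvS (Or.inl h)
    have huA : u ∉ A := fun h => hvS' (hA u hu h v hv hvA huv ▸ hc)
    exact ⟨u, ⟨hu, huA⟩, huS.resolve_right huA, v, ⟨hv, hvA⟩, hvS', huv⟩
  · obtain ⟨u, hu, huS, v, hv, hvS, huv⟩ := hK (S \ A) ⟨x, hx.1, hxS, hx.2⟩
      ⟨y, hy.1, fun h => hyS h.1⟩
    have hvA : v ∉ A := fun h => hc (hA v hv h u hu huS.2 huv.symm ▸ huS.1)
    exact ⟨u, ⟨hu, huS.2⟩, huS.1, v, ⟨hv, hvA⟩, fun h => hvS ⟨h, hvA⟩, huv⟩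

theorem cutConnected_supp {s : Set V} (c : (Q.induce s).ConnectedComponent) :
    Q.CutConnected (Subtype.val '' c.supp) := by
  classical
  rintro S ⟨_, ⟨x, hx, rfl⟩, hxS⟩ ⟨_, ⟨y, hy, rfl⟩, hyS⟩
  obtain ⟨p⟩ : (Q.induce s).Reachable x y := ConnectedComponent.exact (hx.trans hy.symm)
  obtain ⟨d, hd, h1, h2⟩ := p.exists_boundary_dart (Subtype.val ⁻¹' S) hxS hyS
  have hfst : (Q.induce s).connectedComponentMk d.fst = c := by
    rw [← hx]
    exact ConnectedComponent.sound
      (p.takeUntil d.fst (p.dart_fst_mem_support_of_mem_darts hd)).reachable.symm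
  have hsnd : (Q.induce s).connectedComponentMk d.snd = c := by
    rw [← hfst]
    exact ConnectedComponent.sound d.adj.symm.reachable
  exact ⟨d.fst, ⟨d.fst, hfst, rfl⟩, h1, d.snd, ⟨d.snd, hsnd, rfl⟩, h2, d.adj⟩

theorem isPart_supp (c : (Q.induce {b}ᶜ).ConnectedComponent) :
    Q.IsPart b (Subtype.val '' c.supp) where
  nonempty := c.nonempty_supp.image _
  notMem := by
    rintro ⟨x, -, hx⟩
    exact x.2 hx
  conn := cutConnected_supp c
  closed := by
    rintro _ ⟨u, hu, rfl⟩ v huv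
    by_cases hv : v = b
    · exact Or.inr hv
    · refine Or.inl ⟨⟨v, hv⟩, ?_, rfl⟩
      rw [← hu]
      exact ConnectedComponent.sound (Adj.reachable (G := Q.induce {b}ᶜ) huv.symm)

theorem exists_isPart (Q : SimpleGraph V) {x : V} (hx : x ≠ b) : ∃ K, Q.IsPart b K ∧ x ∈ K :=
  ⟨_, isPart_supp ((Q.induce {b}ᶜ).connectedComponentMk ⟨x, hx⟩), ⟨x, hx⟩, rfl, rfl⟩

theorem IsPart.isBranch (h : Q.IsPart b K) (hr : r ∉ K) : Q.IsBranch r b K := by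
  obtain ⟨x, hx⟩ := h.nonempty
  have hxb : x ≠ b := fun e => h.notMem (e ▸ hx)
  refine ⟨hr, (Q.induce {b}ᶜ).connectedComponentMk ⟨x, hxb⟩, ?_⟩
  exact h.eq (isPart_supp _) hx ⟨⟨x, hxb⟩, rfl, rfl⟩

theorem IsDFSTree.not_adj (hQ : G.IsDFSTree Q r) (h : Q.IsPart b K) (h' : Q.IsPart b K')
    (hr : r ∉ K) (hr' : r ∉ K') {u v : V} (hu : u ∈ K) (hv : v ∈ K') (hv' : v ∉ K) :
    ¬ G.Adj u v :=
  hQ.2.2 b K K' (h.isBranch hr) (h'.isBranch hr') (fun e => hv' (e ▸ hv)) u hu v hv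

theorem Preconnected.cutConnected (h : Q.Preconnected) : Q.CutConnected Set.univ := by
  rintro S ⟨x, -, hxS⟩ ⟨y, -, hyS⟩
  obtain ⟨p⟩ := h x y
  obtain ⟨d, -, h1, h2⟩ := p.exists_boundary_dart S hxS hyS
  exact ⟨d.fst, trivial, h1, d.snd, trivial, h2, d.adj⟩

/-- In a forest, a component of `Q - b` contains at most one neighbour of `b`. -/
theorem IsPart.adj_unique (hQ : Q.IsAcyclic) (h : Q.IsPart b K) {u v : V} (hu : u ∈ K) (hv : v ∈ K)
    (hbu : Q.Adj b u) (hbv : Q.Adj b v) : u = v := by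
  by_contra hne
  have hbr := isAcyclic_iff_forall_adj_isBridge.1 hQ hbu
  rw [isBridge_iff] at hbr
  have step : ∀ x y, Q.Adj x y → (x ∈ K ∧ y ∈ K ∨ x = b ∧ y = v) →
      (Q \ fromEdgeSet {s(b, u)}).Adj x y := by
    intro x y hxy hK
    rw [sdiff_adj, fromEdgeSet_adj]
    refine ⟨hxy, fun hcon => ?_⟩
    have := hcon.1
    rw [Set.mem_singleton_iff, Sym2.eq_iff] at this
    have hb := h.notMem
    rcases hK with ⟨hx, hy⟩ | ⟨rfl, rfl⟩
    · rcases this with ⟨rfl, -⟩ | ⟨-, rfl⟩ <;> contradiction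
    · rcases this with ⟨-, rfl⟩ | ⟨-, rfl⟩
      · exact hne rfl
      · exact hb hv
  refine hbr ?_
  by_contra hcon
  have hbv' := (step b v hbv (Or.inr ⟨rfl, rfl⟩)).reachable
  obtain ⟨x, hx, hxS, y, hy, hyS, hxy⟩ := h.conn
    {x | (Q \ fromEdgeSet {s(b, u)}).Reachable b x} ⟨v, hv, hbv'⟩ ⟨u, hu, hcon⟩
  exact hyS (hxS.trans (step x y hxy (Or.inl ⟨hx, hy⟩)).reachable)

end Parts

/-! ### Consequences of the depth-first property -/

section DepthFirst

variable {V : Type*} {G Q : SimpleGraph V} {r b : V} {K K' : Set V}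

/-- Let l be the vertex by which L is attached to w. Both K and K' enter L through l, so l is
neither u nor v. In the tree minus l, either u and v lie in different branches, or they share a
component properly contained in L. -/
theorem IsDFSTree.not_adj_of_mem_part [Finite V] (hQ : G.IsDFSTree Q r) {u v : V}
    (hK : Q.CutConnected K) (hrK : r ∈ K) (huK : u ∈ K) (hvK : v ∉ K)
    (hK' : Q.CutConnected K') (hrK' : r ∈ K') (hvK' : v ∈ K') (huK' : u ∉ K')
    {w : V} {L : Set V} (hL : Q.IsPart w L) (hrL : r ∉ L) (huL : u ∈ L) (hvL : v ∈ L) :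
    ¬ G.Adj u v := by
  induction hn : L.ncard using Nat.strong_induction_on generalizing L w with
  | _ n ih =>
    obtain ⟨y, -, hy, l, -, hl, hyl⟩ := hQ.2.1.connected.preconnected.cutConnected Lᶜ
      ⟨r, trivial, hrL⟩ ⟨u, trivial, fun h => h huL⟩
    rw [Set.notMem_compl_iff] at hl
    obtain rfl : y = w := (hL.closed l hl y hyl.symm).resolve_left hy
    have hexit : Q.ExitsTo Lᶜ l := by
      refine ⟨fun h => h hl, fun x hx z hxz => ?_⟩
      by_cases hz : z ∈ L
      · obtain rfl : x = y := (hL.closed z hz x hxz.symm).resolve_left hx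
        exact Or.inr (hL.adj_unique hQ.2.1.isAcyclic hz hl hxz hyl)
      · exact Or.inl hz
    have hlK : ∀ {M : Set V}, Q.CutConnected M → r ∈ M → ∀ x ∈ M, x ∈ L → l ∈ M := by
      intro M hM hrM x hxM hxL
      by_contra hlM
      exact hM.subset hlM hexit hrM hrL hxM hxL
    have hlu : u ≠ l := fun e => huK' (e ▸ hlK hK' hrK' v hvK' hvL)
    have hlv : v ≠ l := fun e => hvK (e ▸ hlK hK hrK u huK huL)
    obtain ⟨A, hA, huA⟩ := exists_isPart Q hlu
    obtain ⟨B, hB, hvB⟩ := exists_isPart Q hlv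
    have hsub : ∀ {M : Set V}, Q.IsPart l M → ∀ x ∈ M, x ∈ L → M ⊆ L := by
      intro M hM x hxM hxL z hzM
      by_contra hzL
      exact hM.conn.subset hM.notMem hexit hzM hzL hxM hxL
    have hAL := hsub hA u huA huL
    have hrA : r ∉ A := fun h => hrL (hAL h)
    have hrB : r ∉ B := fun h => hrL (hsub hB v hvB hvL h)
    by_cases hvA : v ∈ A
    · refine ih A.ncard ?_ hA hrA huA hvA rfl
      rw [← hn]
      refine Set.ncard_lt_ncard (hAL.ssubset_of_ne ?_) (Set.toFinite L)
      rintro rfl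
      exact hA.notMem hl
    · exact hQ.not_adj hA hB hrA hrB huA hvB hvA

/-- The ends of an edge of `G` are comparable in a depth-first search tree: one of them lies on
every connection of the other to the root. -/
theorem IsDFSTree.not_adj_of_avoid [Finite V] (hQ : G.IsDFSTree Q r) {u v : V}
    (hK : Q.CutConnected K) (hrK : r ∈ K) (huK : u ∈ K) (hvK : v ∉ K)
    (hK' : Q.CutConnected K') (hrK' : r ∈ K') (hvK' : v ∈ K') (huK' : u ∉ K') :
    ¬ G.Adj u v := by
  have hu : u ≠ r := fun e => huK' (e ▸ hrK')
  have hv : v ≠ r := fun e => hvK (e ▸ hrK)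
  obtain ⟨A, hA, huA⟩ := exists_isPart Q hu
  obtain ⟨B, hB, hvB⟩ := exists_isPart Q hv
  by_cases hvA : v ∈ A
  · exact hQ.not_adj_of_mem_part hK hrK huK hvK hK' hrK' hvK' huK' hA hA.notMem huA hvA
  · exact hQ.not_adj hA hB hA.notMem hB.notMem huA hvB hvA

/-- If all tree edges leaving a small side `A` of a separation lead to `b`, then the separator is
contained in `b` together with a single component of the tree minus `b`. -/
theorem IsDFSTree.exists_main_part [Fintype V] [DecidableEq V] (hQ : G.IsDFSTree Q r) {k : ℕ}
    (hk : G.SeparatorBound k) {A T R : Finset V} (h : G.IsSeparation k A T R)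
    (hA : Q.ExitsTo A b) (hcard : A.card + 1 < k) :
    ∃ K, Q.IsPart b K ∧ (∀ v ∈ K, v ∉ A) ∧ (∀ t ∈ T, t = b ∨ t ∈ K) ∧
      (r ∈ K ∨ r ∈ A ∧ ∀ v, v ∈ A ∨ v = b ∨ v ∈ K) := by
  have hbA : b ∉ A := hA.notMem
  have houtside : ∀ {K : Set V}, Q.IsPart b K → ∀ x ∈ K, x ∉ A → ∀ v ∈ K, v ∉ A :=
    fun hK x hxK hxA v hvK hvA => hxA (hK.conn.subset hK.notMem hA hvK hvA hxK)
  obtain ⟨t, htT, htb⟩ : ∃ t ∈ T, t ≠ b :=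
    Finset.exists_mem_ne (by rw [h.card_mid]; omega) b
  by_cases hr : r ∈ A
  · obtain ⟨K, hK, htK⟩ := exists_isPart Q htb
    have hKA := houtside hK t htK (fun hA => h.left_mid t hA htT)
    have hall : ∀ v, v ∈ A ∨ v = b ∨ v ∈ K := by
      by_contra! hcon
      obtain ⟨v, hvA, hvb, hvK⟩ := hcon
      classical
      -- Components of Q - b that avoid the root are pairwise nonadjacent in `G`, so A ∪ {b} would
      -- separate K from v with fewer than k vertices.
      have := hk K.toFinset (insert b A) ⟨t, by simpa using htK⟩
        ⟨v, by simpa using hvK, by simp [hvb, hvA]⟩ ?_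
      · have := Finset.card_insert_le b A
        omega
      · intro u hu w huw
        rw [Set.mem_toFinset] at hu ⊢
        rw [Finset.mem_insert]
        by_contra! hw
        obtain ⟨M, hM, hwM⟩ := exists_isPart Q hw.2.1
        have hMA := houtside hM w hwM hw.2.2
        exact hQ.not_adj hK hM (fun h => hKA r h hr) (fun h => hMA r h hr) hu hwM hw.1 huw
    refine ⟨K, hK, hKA, fun s hs => ?_, Or.inr ⟨hr, hall⟩⟩
    exact (hall s).resolve_left fun hA => h.left_mid s hA hs
  -- A neighbour of s in A lies in a component of Q - b contained in A, hence without the root. If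
  -- the component of s also avoided the root, these two branches would be adjacent.
  · have key : ∀ s ∈ T, s ≠ b → ∃ K, Q.IsPart b K ∧ s ∈ K ∧ r ∈ K := by
      intro s hs hsb
      obtain ⟨a, ha, has⟩ := h.exists_adj hk hs
      obtain ⟨M, hM, haM⟩ := exists_isPart Q (x := a) (b := b) (fun e => hbA (e ▸ ha))
      obtain ⟨K, hK, hsK⟩ := exists_isPart Q hsb
      have hMA : M ⊆ A := hM.conn.subset hM.notMem hA haM ha
      refine ⟨K, hK, hsK, ?_⟩
      by_contra hrK
      exact hQ.not_adj hM hK (fun h => hr (hMA h)) hrK haM hsK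
        (fun hsM => h.left_mid s (hMA hsM) hs) has
    obtain ⟨K, hK, -, hrK⟩ := key t htT htb
    refine ⟨K, hK, houtside hK r hrK hr, fun s hs => ?_, Or.inl hrK⟩
    by_cases hsb : s = b
    · exact Or.inl hsb
    · obtain ⟨K', hK', hsK', hrK'⟩ := key s hs hsb
      rw [hK.eq hK' hrK hrK']
      exact Or.inr hsK'

end DepthFirst

/-! ### Attachment of ends and uncrossing -/

section Exits

variable {V : Type*} [DecidableEq V] {G Q : SimpleGraph V} {k m : ℕ}
  {P : Finset V → Prop} {W : Set V} {A A' E T R F S H : Finset V} {a b u v : V}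

/-- A connected part of the tree that meets the separator only in `A` but both sides of it
contains edges leaving `A` to each side. -/
theorem IsSeparation.exists_exit (h : G.IsSeparation k F S H) (hQ : Q ≤ G) {K : Set V}
    (hK : Q.CutConnected K) (hA : ∀ v ∈ K, v ∈ S → v ∈ A) (hF : ∃ x ∈ K, x ∈ F)
    (hH : ∃ y ∈ K, y ∈ H) : ∃ u ∈ A, u ∈ K ∧ ∃ v ∈ K, v ∈ F ∧ Q.Adj u v := by
  obtain ⟨y, hyK, hyH⟩ := hH
  obtain ⟨v, hvK, hvF, u, huK, huF, hvu⟩ := hK F hF ⟨y, hyK, fun hF => h.left_right y hF hyH⟩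
  exact ⟨u, hA u huK ((h.adj_left hvF (hQ hvu)).resolve_left huF), huK, v, hvK, hvF, hvu.symm⟩

/-- An end avoiding `W` is attached to the rest of the tree at a single vertex. -/
theorem TreeSetting.exists_exitsTo (hS : TreeSetting G Q k m P W) (hconn : Q.Preconnected)
    (hE : G.IsEnd k P E T R) (hW : ∀ v ∈ E, v ∉ W) :
    ∃ a ∈ E, ∃ b ∈ T, Q.Adj a b ∧ Q.ExitsTo E b := by
  obtain ⟨x, hx⟩ := hE.sep.nonempty_left
  obtain ⟨y, hy⟩ := hE.sep.nonempty_right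
  obtain ⟨a, -, ha, b, -, hb, hab⟩ := hconn.cutConnected E ⟨x, trivial, hx⟩
    ⟨y, trivial, fun hF => hE.sep.left_right y hF hy⟩
  have hbT := (hE.sep.adj_left ha (hS.le hab)).resolve_left hb
  refine ⟨a, ha, b, hbT, hab, hb, fun u hu v huv => ?_⟩
  by_cases hv : v ∈ E
  · exact Or.inl hv
  · exact Or.inr (hS.exit_unique hE hu ((hE.sep.adj_left hu (hS.le huv)).resolve_left hv) huv
      (fun h => hW u hu h.1) ha hbT hab (fun h => hW a ha h.1))

/-- A separation through a tree edge disjoint from an end can be chosen not to cut the end. -/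
theorem TreeSetting.exists_uncrossed_aux (hS : TreeSetting G Q k m P W)
    (hE : G.IsEnd k P E T R) (hEm : E.card = m) (h : G.IsSeparation k F S H) (huv : Q.Adj u v)
    (hW : ¬ (u ∈ W ∧ v ∈ W)) (hu : u ∈ S) (hv : v ∈ S) (huE : u ∉ E) (hvE : v ∉ E)
    (hne : (E ∩ F).Nonempty) :
    ∃ F' S' H', G.IsSeparation k F' S' H' ∧ u ∈ S' ∧ v ∈ S' ∧ E ⊆ F' := by
  have hcells := hE.sep.card_cells h
  have hle := hE.sep.le_corner h hS.bound hne
  have hH := hS.le_card h.symm (hS.of_edge h huv hW hu hv)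
  have hpos : 0 < (E ∩ F).card := Finset.card_pos.2 hne
  -- The corner bound at E ∩ F gives |T ∩ H| ≤ |E ∩ S|, so H has at most |E| - |E ∩ F| < m vertices
  -- outside R.
  have hRH : (R ∩ H).Nonempty := by
    rw [← Finset.card_pos]
    omega
  have hle' := hE.sep.symm.le_corner h.symm hS.bound hRH
  have hsep := hE.sep.symm.corner h.symm hRH (by omega)
  refine ⟨_, _, _, hsep.symm, ?_, ?_, Finset.subset_union_left⟩
  · have := hE.sep.cover u
    simp only [Finset.mem_union, Finset.mem_inter]
    tauto
  · have := hE.sep.cover v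
    simp only [Finset.mem_union, Finset.mem_inter]
    tauto

theorem TreeSetting.exists_uncrossed (hS : TreeSetting G Q k m P W)
    (hE : G.IsEnd k P E T R) (hEm : E.card = m) (h : G.IsSeparation k F S H) (huv : Q.Adj u v)
    (hW : ¬ (u ∈ W ∧ v ∈ W)) (hu : u ∈ S) (hv : v ∈ S) (huE : u ∉ E) (hvE : v ∉ E) :
    E ⊆ S ∨ ∃ F' S' H', G.IsSeparation k F' S' H' ∧ u ∈ S' ∧ v ∈ S' ∧ E ⊆ F' := by
  by_cases h1 : (E ∩ F).Nonempty
  · exact Or.inr (hS.exists_uncrossed_aux hE hEm h huv hW hu hv huE hvE h1)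
  by_cases h2 : (E ∩ H).Nonempty
  · exact Or.inr (hS.exists_uncrossed_aux hE hEm h.symm huv hW hu hv huE hvE h2)
  refine Or.inl fun x hx => ?_
  rcases h.cover x with h3 | h3 | h3
  · exact absurd ⟨x, Finset.mem_inter.2 ⟨hx, h3⟩⟩ h1
  · exact h3
  · exact absurd ⟨x, Finset.mem_inter.2 ⟨hx, h3⟩⟩ h2

end Exits

/-! ### Anchored ends and triads -/

section Anchored

variable {V : Type*} [Fintype V] [DecidableEq V] {G Q : SimpleGraph V} {k m : ℕ}
  {P : Finset V → Prop} {W : Set V} {r : V} {A T R F S H X : Finset V} {a b : V} {K : Set V}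

/-- An end `A` that is attached to the rest of the tree at the single vertex `b`, by the edge `ab`
among others, together with the component `K` of the tree minus `b` that contains the remaining
neighbours of `A`. -/
structure IsAnchored (G Q : SimpleGraph V) (k m : ℕ) (P : Finset V → Prop) (W : Set V) (r : V)
    (A T R : Finset V) (a b : V) (K : Set V) : Prop where
  isEnd : G.IsEnd k P A T R
  card : A.card = m
  mem : a ∈ A
  mem_mid : b ∈ T
  adj : Q.Adj a b
  notMem_W : ∀ v ∈ A, v ∉ W
  exitsTo : Q.ExitsTo A b
  isPart : Q.IsPart b K
  notMem : ∀ v ∈ K, v ∉ A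
  mid : ∀ t ∈ T, t = b ∨ t ∈ K
  root : r ∈ K ∨ r ∈ A ∧ ∀ v, v ∈ A ∨ v = b ∨ v ∈ K

theorem IsSeparation.exists_isAnchored (h : G.IsSeparation k F T R) (hP : P T)
    (hS : TreeSetting G Q k m P W) (hQ : G.IsDFSTree Q r) (hW : ∀ v ∈ F, v ∉ W) :
    k = 2 * m + 1 ∧ ∃ E T' R' a b K, IsAnchored G Q k m P W r E T' R' a b K ∧ E ⊆ F := by
  obtain ⟨E, T', R', hE, hsub⟩ := h.exists_isEnd hP
  have hEW : ∀ v ∈ E, v ∉ W := fun v hv => hW v (hsub hv)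
  obtain ⟨a, ha, b, hb, hab, hexit⟩ := hS.exists_exitsTo hQ.2.1.connected.preconnected hE hEW
  have habW : ¬ (a ∈ W ∧ b ∈ W) := fun h => hEW a ha h.1
  obtain ⟨F₁, T₁, R₁, h₁, haT, hbT⟩ := hS.exists_sep hab habW
  obtain ⟨-, hm, hk, -⟩ := hS.end_crossing hE h₁ ha hb hab habW haT hbT
  have := hS.two_le
  obtain ⟨K, hK, hKE, hKT, hroot⟩ := hQ.exists_main_part hS.bound hE.sep hexit (by omega)
  exact ⟨hk, E, T', R', a, b, K, ⟨hE, hm, ha, hb, hab, hEW, hexit, hK, hKE, hKT, hroot⟩, hsub⟩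

/-- As `W` is a clique, it cannot meet both sides. This lets ends avoiding `W` be found inside a
suitable side. -/
theorem TreeSetting.free_side (hS : TreeSetting G Q k m P W) (h : G.IsSeparation k F T R) :
    (∀ v ∈ F, v ∉ W) ∨ (∀ v ∈ R, v ∉ W) := by
  by_contra! hcon
  obtain ⟨⟨u, hu, huW⟩, v, hv, hvW⟩ := hcon
  refine h.not_adj u hu v hv (hS.clique u huW v hvW ?_)
  rintro rfl
  exact h.left_right u hu hv

namespace IsAnchored

variable (hA : IsAnchored G Q k m P W r A T R a b K)
include hA

theorem edge_notMem : ¬ (a ∈ W ∧ b ∈ W) := fun h => hA.notMem_W a hA.mem h.1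

theorem notMem_end : b ∉ A := hA.exitsTo.notMem

theorem crossing (hS : TreeSetting G Q k m P W) (h : G.IsSeparation k F S H) (ha : a ∈ S)
    (hb : b ∈ S) : A ⊆ S ∧ (T ∩ F).card = m ∧ (T ∩ H).card = m ∧ T ∩ S = {b} := by
  have := hS.end_crossing hA.isEnd h hA.mem hA.mem_mid hA.adj hA.edge_notMem ha hb
  tauto

theorem exists_mem_part (hS : TreeSetting G Q k m P W) (h : G.IsSeparation k F S H) (ha : a ∈ S)
    (hb : b ∈ S) : ∃ x ∈ K, x ∈ T ∧ x ∈ F := by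
  have hc := (hA.crossing hS h ha hb).2.1
  have := hS.two_le
  obtain ⟨x, hx⟩ : (T ∩ F).Nonempty := Finset.card_pos.1 (by omega)
  rw [Finset.mem_inter] at hx
  refine ⟨x, (hA.mid x hx.1).resolve_left ?_, hx⟩
  rintro rfl
  exact h.left_mid x hx.2 hb

theorem mem_of_mem_mid (hS : TreeSetting G Q k m P W) (hk : k = 2 * m + 1)
    (h : G.IsSeparation k F S H) (ha : a ∈ S) (hb : b ∈ S) (hX : X ⊆ S) (hXm : m ≤ X.card)
    (hXA : ∀ v ∈ X, v ∉ A) (hXb : b ∉ X) {v : V} (hv : v ∈ S) : v ∈ A ∨ v = b ∨ v ∈ X := by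
  have hsub : insert b (A ∪ X) ⊆ S :=
    Finset.insert_subset hb (Finset.union_subset (hA.crossing hS h ha hb).1 hX)
  have hcard : (insert b (A ∪ X)).card = A.card + X.card + 1 := by
    rw [Finset.card_insert_of_notMem (by simp [hA.notMem_end, hXb]),
      Finset.card_union_of_disjoint]
    rw [Finset.disjoint_right]
    exact hXA
  have heq := Finset.eq_of_subset_of_card_le hsub (by rw [hcard, hA.card, h.card_mid]; omega)
  rw [← heq] at hv
  simp only [Finset.mem_insert, Finset.mem_union] at hv
  tauto

/-- If a separator through the anchor consists of the end, the anchor and a set `X`, then tree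
edges leave `X` to each side. -/
theorem exists_exit (hS : TreeSetting G Q k m P W) (hk : k = 2 * m + 1)
    (h : G.IsSeparation k F S H) (ha : a ∈ S) (hb : b ∈ S) (hX : X ⊆ S) (hXm : m ≤ X.card)
    (hXA : ∀ v ∈ X, v ∉ A) (hXb : b ∉ X) : ∃ u ∈ X, u ∈ K ∧ ∃ v ∈ K, v ∈ F ∧ Q.Adj u v := by
  obtain ⟨x, hxK, -, hxF⟩ := hA.exists_mem_part hS h ha hb
  obtain ⟨y, hyK, -, hyH⟩ := hA.exists_mem_part hS h.symm ha hb
  refine h.exists_exit hS.le hA.isPart.conn (fun v hvK hvS => ?_) ⟨x, hxK, hxF⟩ ⟨y, hyK, hyH⟩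
  rcases hA.mem_of_mem_mid hS hk h ha hb hX hXm hXA hXb hvS with h | rfl | h
  · exact absurd h (hA.notMem v hvK)
  · exact absurd hvK hA.isPart.notMem
  · exact h

/-- A separator through the anchor contains no further set attached to the tree at one vertex. -/
theorem not_exitsTo (hS : TreeSetting G Q k m P W) (hk : k = 2 * m + 1)
    (h : G.IsSeparation k F S H) (ha : a ∈ S) (hb : b ∈ S) (hX : X ⊆ S) (hXm : m ≤ X.card)
    (hXA : ∀ v ∈ X, v ∉ A) (hXb : b ∉ X) {c : V} : ¬ Q.ExitsTo X c := by
  intro hc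
  obtain ⟨u, huX, -, v, -, hvF, huv⟩ := hA.exists_exit hS hk h ha hb hX hXm hXA hXb
  obtain ⟨u', huX', -, v', -, hvH, huv'⟩ := hA.exists_exit hS hk h.symm ha hb hX hXm hXA hXb
  have h1 := (hc.exit u huX v huv).resolve_left fun hvX => h.left_mid v hvF (hX hvX)
  have h2 := (hc.exit u' huX' v' huv').resolve_left fun hvX => h.mid_right v' (hX hvX) hvH
  subst h1 h2
  exact h.left_right _ hvF hvH

end IsAnchored

/-- Two anchored ends `A₁`, `A₂` and a third end `A₃` such that `A₁` and `A₃` lie in a common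
separator `S₁` and the neighbourhood `S₂` of `A₃` contains `A₂`. -/
structure IsTriad (G Q : SimpleGraph V) (k m : ℕ) (P : Finset V → Prop) (W : Set V) (r : V)
    (A₁ T₁ R₁ : Finset V) (a₁ b₁ : V) (K₁ : Set V) (A₂ T₂ R₂ : Finset V) (a₂ b₂ : V) (K₂ : Set V)
    (F₁ S₁ H₁ F₂ S₂ A₃ : Finset V) : Prop where
  left : IsAnchored G Q k m P W r A₁ T₁ R₁ a₁ b₁ K₁
  right : IsAnchored G Q k m P W r A₂ T₂ R₂ a₂ b₂ K₂
  card_eq : k = 2 * m + 1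
  sep : G.IsSeparation k F₁ S₁ H₁
  isEnd : G.IsEnd k P A₃ S₂ F₂
  card : A₃.card = m
  left_mem : a₁ ∈ S₁
  left_anchor : b₁ ∈ S₁
  right_mem : a₂ ∈ S₂
  right_anchor : b₂ ∈ S₂
  left_sub : A₁ ⊆ F₂
  right_sub : A₂ ⊆ F₁
  sub : A₃ ⊆ S₁

variable {A₁ T₁ R₁ A₂ T₂ R₂ F₁ S₁ H₁ F₂ S₂ H₂ A₃ : Finset V} {a₁ b₁ a₂ b₂ : V} {K₁ K₂ : Set V}

/-- S₁ contains the disjoint sets A₁, {b₁} and H₂, which leaves at most m vertices for H₂. A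
fragment of the least possible size m is an end. -/
theorem IsAnchored.isTriad (hA₁ : IsAnchored G Q k m P W r A₁ T₁ R₁ a₁ b₁ K₁)
    (hA₂ : IsAnchored G Q k m P W r A₂ T₂ R₂ a₂ b₂ K₂) (hS : TreeSetting G Q k m P W)
    (hk : k = 2 * m + 1) (h₁ : G.IsSeparation k F₁ S₁ H₁) (h₂ : G.IsSeparation k F₂ S₂ H₂)
    (ha₁ : a₁ ∈ S₁) (hb₁ : b₁ ∈ S₁) (ha₂ : a₂ ∈ S₂) (hb₂ : b₂ ∈ S₂) (hsub₁ : A₁ ⊆ F₂)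
    (hsub₂ : A₂ ⊆ F₁) (hsub : H₂ ⊆ S₁) :
    IsTriad G Q k m P W r A₁ T₁ R₁ a₁ b₁ K₁ A₂ T₂ R₂ a₂ b₂ K₂ F₁ S₁ H₁ F₂ S₂ H₂ := by
  have hP := hS.of_edge h₂ hA₂.adj hA₂.edge_notMem ha₂ hb₂
  have hle := hS.le_card h₂.symm hP
  have hbH : b₁ ∉ H₂ := by
    intro hb
    rcases h₂.adj_left (hsub₁ hA₁.mem) (hS.le hA₁.adj) with h | h
    · exact h₂.left_right _ h hb
    · exact h₂.mid_right _ h hb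
  have hcard : H₂.card ≤ m := by
    have hsub' : insert b₁ (A₁ ∪ H₂) ⊆ S₁ := Finset.insert_subset hb₁
      (Finset.union_subset (hA₁.crossing hS h₁ ha₁ hb₁).1 hsub)
    have := Finset.card_le_card hsub'
    rw [Finset.card_insert_of_notMem (by simp [hA₁.notMem_end, hbH]),
      Finset.card_union_of_disjoint, hA₁.card, h₁.card_mid] at this
    · omega
    · rw [Finset.disjoint_left]
      exact fun v hv => h₂.left_right v (hsub₁ hv)
  obtain ⟨A₃, T₃, R₃, hA₃, hsub₃⟩ := h₂.symm.exists_isEnd hP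
  have heq : A₃ = H₂ := Finset.eq_of_subset_of_card_le hsub₃
    (hcard.trans (hS.le_card hA₃.sep hA₃.fam))
  subst heq
  exact ⟨hA₁, hA₂, hk, h₁, ⟨h₂.symm, hP, hA₃.minimal⟩, le_antisymm hcard hle, ha₁, hb₁, ha₂, hb₂,
    hsub₁, hsub₂, hsub⟩

/-- The sides of two separations through anchored ends that do not contain the ends are disjoint. -/
theorem IsAnchored.not_nonempty_inter (hA₁ : IsAnchored G Q k m P W r A₁ T₁ R₁ a₁ b₁ K₁)
    (hA₂ : IsAnchored G Q k m P W r A₂ T₂ R₂ a₂ b₂ K₂) (hS : TreeSetting G Q k m P W)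
    (hk : k = 2 * m + 1) (h₁ : G.IsSeparation k F₁ S₁ H₁) (h₂ : G.IsSeparation k F₂ S₂ H₂)
    (ha₁ : a₁ ∈ S₁) (hb₁ : b₁ ∈ S₁) (ha₂ : a₂ ∈ S₂) (hb₂ : b₂ ∈ S₂) (hsub₁ : A₁ ⊆ F₂)
    (hsub₂ : A₂ ⊆ F₁) : ¬ (H₁ ∩ H₂).Nonempty := by
  intro hne
  have hAS₁ := (hA₁.crossing hS h₁ ha₁ hb₁).1
  have hAS₂ := (hA₂.crossing hS h₂ ha₂ hb₂).1
  have hcells := h₁.card_cells h₂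
  have hle := h₁.symm.le_corner h₂.symm hS.bound hne
  have hs₁ : A₁ ⊆ S₁ ∩ F₂ := fun v hv => Finset.mem_inter.2 ⟨hAS₁ hv, hsub₁ hv⟩
  have hs₂ : A₂ ⊆ F₁ ∩ S₂ := fun v hv => Finset.mem_inter.2 ⟨hsub₂ hv, hAS₂ hv⟩
  have hc₁ := Finset.card_le_card hs₁
  have hc₂ := Finset.card_le_card hs₂
  rw [hA₁.card] at hc₁
  rw [hA₂.card] at hc₂
  have hb₁' := h₂.adj_left (hsub₁ hA₁.mem) (hS.le hA₁.adj)
  have hb₂' := h₁.adj_left (hsub₂ hA₂.mem) (hS.le hA₂.adj)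
  have big₁ : b₁ ∈ F₂ → m + 1 ≤ (S₁ ∩ F₂).card := by
    intro hb
    rw [← hA₁.card, ← Finset.card_insert_of_notMem hA₁.notMem_end]
    exact Finset.card_le_card (Finset.insert_subset (by simp [hb, hb₁]) hs₁)
  have big₂ : b₂ ∈ F₁ → m + 1 ≤ (F₁ ∩ S₂).card := by
    intro hb
    rw [← hA₂.card, ← Finset.card_insert_of_notMem hA₂.notMem_end]
    exact Finset.card_le_card (Finset.insert_subset (by simp [hb, hb₂]) hs₂)
  have one₁ : b₁ ∈ S₂ → 1 ≤ (S₁ ∩ S₂).card :=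
    fun hb => Finset.card_pos.2 ⟨b₁, Finset.mem_inter.2 ⟨hb₁, hb⟩⟩
  have one₂ : b₂ ∈ S₁ → 1 ≤ (S₁ ∩ S₂).card :=
    fun hb => Finset.card_pos.2 ⟨b₂, Finset.mem_inter.2 ⟨hb, hb₂⟩⟩
  -- The corner bound at H₁ ∩ H₂ limits the corner set of F₁ ∩ F₂ to 2m + 1 vertices. A₁ and A₂
  -- occupy 2m of them, so b₁ and b₂ must coincide and lie in S₁ ∩ S₂.
  have hbS₁ : b₁ ∈ S₂ := by
    refine hb₁'.resolve_left fun hb => ?_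
    have := big₁ hb
    rcases hb₂' with h | h
    · have := big₂ h
      omega
    · have := one₂ h
      omega
  have hone := one₁ hbS₁
  have hbS₂ : b₂ ∈ S₁ := by
    refine hb₂'.resolve_left fun hb => ?_
    have := big₂ hb
    omega
  have hone' : (S₁ ∩ S₂).card ≤ 1 := by omega
  obtain rfl : b₁ = b₂ := Finset.card_le_one.1 hone' b₁ (Finset.mem_inter.2 ⟨hb₁, hbS₁⟩) b₂
    (Finset.mem_inter.2 ⟨hbS₂, hb₂⟩)
  have heq₁ := Finset.eq_of_subset_of_card_le hs₁ (by rw [hA₁.card]; omega)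
  have heq₂ := Finset.eq_of_subset_of_card_le hs₂ (by rw [hA₂.card]; omega)
  obtain ⟨x, hxK, hxT, hxF⟩ := hA₁.exists_mem_part hS h₁ ha₁ hb₁
  obtain ⟨y, hyK, -, hyH⟩ := hA₁.exists_mem_part hS h₁.symm ha₁ hb₁
  have hKA₂ : ∀ z ∈ K₁, z ∉ A₂ := fun z hzK hzA => h₁.left_right y
    (hsub₂ (hA₁.isPart.conn.subset hA₁.isPart.notMem hA₂.exitsTo hzK hzA hyK)) hyH
  have hxF₂ : x ∈ F₂ := by
    obtain ⟨a, ha, hax⟩ := hA₁.isEnd.sep.exists_adj hS.bound hxT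
    refine (h₂.adj_left (hsub₁ ha) hax).resolve_right fun h => hKA₂ x hxK ?_
    rw [heq₂]
    exact Finset.mem_inter.2 ⟨hxF, h⟩
  -- The corner set of F₁ ∩ F₂ is now A₁ ∪ {b₁} ∪ A₂, which K₁ avoids although it reaches from F₁ ∩
  -- F₂ into H₁.
  obtain ⟨u, -, hu, v, hvK, hv, huv⟩ := hA₁.isPart.conn ↑(F₁ ∩ F₂)
    ⟨x, hxK, by simp [hxF, hxF₂]⟩ ⟨y, hyK, fun h => by
      simp only [Finset.coe_inter, Set.mem_inter_iff, Finset.mem_coe] at h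
      exact h₁.left_right y h.1 hyH⟩
  have hv' := (h₁.corner_adj h₂ hu (hS.le huv)).resolve_left hv
  simp only [Finset.mem_union] at hv'
  rcases hv' with (h | h) | h
  · exact hKA₂ v hvK (heq₂ ▸ h)
  · have : b₁ = v := Finset.card_le_one.1 hone' b₁ (Finset.mem_inter.2 ⟨hb₁, hbS₁⟩) v h
    exact hA₁.isPart.notMem (this ▸ hvK)
  · exact hA₁.notMem v hvK (heq₁ ▸ h)

/-- Choose an anchored end A₂ in F₁ and a separation through its edge with A₁ ⊆ F₂. Since H₁ ∩ H₂ is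
empty, emptiness of F₁ ∩ H₂ or of H₁ ∩ F₂ puts H₂ or H₁ inside the other separator and gives a
triad. Otherwise F₁ ∩ H₂ is a fragment whose separator contains a₂ and b₂. It is smaller than F₁
because it misses a₂, and the argument repeats with A₂. -/
theorem IsAnchored.exists_isTriad (hA₁ : IsAnchored G Q k m P W r A₁ T₁ R₁ a₁ b₁ K₁)
    (hS : TreeSetting G Q k m P W) (hQ : G.IsDFSTree Q r) (h₁ : G.IsSeparation k F₁ S₁ H₁)
    (ha₁ : a₁ ∈ S₁) (hb₁ : b₁ ∈ S₁) (hW : ∀ v ∈ F₁, v ∉ W) :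
    ∃ A₁ T₁ R₁ a₁ b₁ K₁ A₂ T₂ R₂ a₂ b₂ K₂ F₁ S₁ H₁ F₂ S₂ A₃,
      IsTriad G Q k m P W r A₁ T₁ R₁ a₁ b₁ K₁ A₂ T₂ R₂ a₂ b₂ K₂ F₁ S₁ H₁ F₂ S₂ A₃ := by
  induction hn : F₁.card using Nat.strong_induction_on
    generalizing A₁ T₁ R₁ a₁ b₁ K₁ F₁ S₁ H₁ with
  | _ n ih =>
    have hP₁ := hS.of_edge h₁ hA₁.adj hA₁.edge_notMem ha₁ hb₁
    obtain ⟨hk, A₂, T₂, R₂, a₂, b₂, K₂, hA₂, hsub₂⟩ := h₁.exists_isAnchored hP₁ hS hQ hW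
    have hAS₁ := (hA₁.crossing hS h₁ ha₁ hb₁).1
    have ha₂ : a₂ ∉ A₁ := fun h => h₁.left_mid a₂ (hsub₂ hA₂.mem) (hAS₁ h)
    have hb₂ : b₂ ∉ A₁ := by
      intro h
      rcases hA₁.exitsTo.exit b₂ h a₂ hA₂.adj.symm with h' | rfl
      · exact ha₂ h'
      · exact h₁.left_mid _ (hsub₂ hA₂.mem) hb₁
    obtain ⟨F₂, S₂, H₂, h₂, haS₂, hbS₂⟩ := hS.exists_sep hA₂.adj hA₂.edge_notMem
    rcases hS.exists_uncrossed hA₁.isEnd hA₁.card h₂ hA₂.adj hA₂.edge_notMem haS₂ hbS₂ ha₂ hb₂ with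
      hsub | ⟨F₂, S₂, H₂, h₂, haS₂, hbS₂, hsub₁⟩
    · exact absurd hA₁.exitsTo (hA₂.not_exitsTo hS hk h₂ haS₂ hbS₂ hsub hA₁.card.ge
        (fun v hv hv' => h₁.left_mid v (hsub₂ hv') (hAS₁ hv)) hb₂)
    have hHH := hA₁.not_nonempty_inter hA₂ hS hk h₁ h₂ ha₁ hb₁ haS₂ hbS₂ hsub₁ hsub₂
    by_cases hFH : (F₁ ∩ H₂).Nonempty
    · by_cases hHF : (H₁ ∩ F₂).Nonempty
      · have hcells := h₁.card_cells h₂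
        have hle := h₁.le_corner h₂.symm hS.bound hFH
        have hle' := h₁.symm.le_corner h₂ hS.bound hHF
        have hsep := h₁.corner h₂.symm hFH (by omega)
        have hb₂' := h₁.adj_left (hsub₂ hA₂.mem) (hS.le hA₂.adj)
        refine ih (F₁ ∩ H₂).card ?_ hA₂ hsep ?_ ?_ ?_ rfl
        · rw [← hn]
          refine Finset.card_lt_card (Finset.inter_subset_left.ssubset_of_ne fun he => ?_)
          have : a₂ ∈ F₁ ∩ H₂ := by rw [he]; exact hsub₂ hA₂.mem
          exact h₂.mid_right a₂ haS₂ (Finset.mem_inter.1 this).2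
        · simp [hsub₂ hA₂.mem, haS₂]
        · simp only [Finset.mem_union, Finset.mem_inter]
          tauto
        · exact fun v hv => hW v (Finset.mem_inter.1 hv).1
      · refine ⟨_, _, _, _, _, _, _, _, _, _, _, _, _, _, _, _, _, _,
          hA₂.isTriad hA₁ hS hk h₂ h₁ haS₂ hbS₂ ha₁ hb₁ hsub₂ hsub₁ fun v hv => ?_⟩
        rcases h₂.cover v with h | h | h
        · exact absurd ⟨v, Finset.mem_inter.2 ⟨hv, h⟩⟩ hHF
        · exact h
        · exact absurd ⟨v, Finset.mem_inter.2 ⟨hv, h⟩⟩ hHH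
    · refine ⟨_, _, _, _, _, _, _, _, _, _, _, _, _, _, _, _, _, _,
        hA₁.isTriad hA₂ hS hk h₁ h₂ ha₁ hb₁ haS₂ hbS₂ hsub₁ hsub₂ fun v hv => ?_⟩
      rcases h₁.cover v with h | h | h
      · exact absurd ⟨v, Finset.mem_inter.2 ⟨h, hv⟩⟩ hFH
      · exact h
      · exact absurd ⟨v, Finset.mem_inter.2 ⟨h, hv⟩⟩ hHH

theorem TreeSetting.exists_isTriad (hS : TreeSetting G Q k m P W) (hQ : G.IsDFSTree Q r)
    (h : G.IsSeparation k F S H) (hP : P S) :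
    ∃ A₁ T₁ R₁ a₁ b₁ K₁ A₂ T₂ R₂ a₂ b₂ K₂ F₁ S₁ H₁ F₂ S₂ A₃,
      IsTriad G Q k m P W r A₁ T₁ R₁ a₁ b₁ K₁ A₂ T₂ R₂ a₂ b₂ K₂ F₁ S₁ H₁ F₂ S₂ A₃ := by
  wlog hW : ∀ v ∈ F, v ∉ W generalizing F H
  · exact this h.symm ((hS.free_side h).resolve_left hW)
  obtain ⟨-, A, T', R', a, b, K, hA, -⟩ := h.exists_isAnchored hP hS hQ hW
  obtain ⟨F₁, S₁, H₁, h₁, ha, hb⟩ := hS.exists_sep hA.adj hA.edge_notMem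
  rcases hS.free_side h₁ with hW₁ | hW₁
  · exact hA.exists_isTriad hS hQ h₁ ha hb hW₁
  · exact hA.exists_isTriad hS hQ h₁.symm ha hb hW₁

theorem IsTriad.anchor_notMem
    (hT : IsTriad G Q k m P W r A₁ T₁ R₁ a₁ b₁ K₁ A₂ T₂ R₂ a₂ b₂ K₂ F₁ S₁ H₁ F₂ S₂ A₃)
    (hQ : Q ≤ G) : b₁ ∉ A₃ := by
  intro hb
  rcases hT.isEnd.sep.symm.adj_left (hT.left_sub hT.left.mem) (hQ hT.left.adj) with h | h
  · exact hT.isEnd.sep.left_right _ hb h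
  · exact hT.isEnd.sep.left_mid _ hb h

theorem IsTriad.not_exitsTo
    (hT : IsTriad G Q k m P W r A₁ T₁ R₁ a₁ b₁ K₁ A₂ T₂ R₂ a₂ b₂ K₂ F₁ S₁ H₁ F₂ S₂ A₃)
    (hS : TreeSetting G Q k m P W) {c : V} : ¬ Q.ExitsTo A₃ c :=
  hT.left.not_exitsTo hS hT.card_eq hT.sep hT.left_mem hT.left_anchor hT.sub hT.card.ge
    (fun v hv hv' => hT.isEnd.sep.left_right v hv (hT.left_sub hv')) (hT.anchor_notMem hS.le)

/-- If every edge of a depth-first search tree lies in a smallest separator, then the family is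
empty. -/
theorem TreeSetting.not_of_empty (hS : TreeSetting G Q k m P ∅) (hQ : G.IsDFSTree Q r)
    (h : G.IsSeparation k F S H) : ¬ P S := by
  intro hP
  obtain ⟨A₁, T₁, R₁, a₁, b₁, K₁, A₂, T₂, R₂, a₂, b₂, K₂, F₁, S₁, H₁, F₂, S₂, A₃, hT⟩ :=
    hS.exists_isTriad hQ h hP
  obtain ⟨-, -, b, -, -, hb⟩ := hS.exists_exitsTo hQ.2.1.connected.preconnected hT.isEnd
    (fun v _ => Set.notMem_empty v)
  exact hT.not_exitsTo hS hb

end Anchored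

/-! ### One exceptional edge: all fragments are large -/

section AllSeparators

variable {V : Type*} [Fintype V] [DecidableEq V] {G Q : SimpleGraph V} {k m : ℕ} {W : Set V}
  {r : V} {E T R E' T' R' F S H : Finset V}

/-- The family of all vertex sets. -/
abbrev AllSets {V : Type*} (_ : Finset V) : Prop := True

/-- Two disjoint ends are either nonadjacent or each lies in the neighbourhood of the other. -/
theorem TreeSetting.subset_of_mem_mid (hS : TreeSetting G Q k m AllSets W)
    (hE : G.IsEnd k AllSets E T R) (hE' : G.IsEnd k AllSets E' T' R') (hcard : E.card ≤ m)
    (hdisj : ∀ v ∈ E, v ∉ E') {v : V} (hv : v ∈ E) (hv' : v ∈ T') : E ⊆ T' := by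
  have hEE : (E ∩ E').card = 0 := by
    rw [Finset.card_eq_zero, ← Finset.disjoint_iff_inter_eq_empty, Finset.disjoint_left]
    exact fun v => hdisj v
  have hm := hS.le_card hE'.sep hE'.fam
  have hcells := hE.sep.card_cells hE'.sep
  by_cases hne : (E ∩ R').Nonempty
  · exfalso
    have hpos : 0 < (E ∩ R').card := Finset.card_pos.2 hne
    have hle := hE.sep.le_corner hE'.sep.symm hS.bound hne
    have hlt : (E ∩ T').card + (T ∩ T').card + (T ∩ R').card ≠ k := by
      intro heq
      have := hE.minimal (hE.sep.corner hE'.sep.symm hne heq) trivial Finset.inter_subset_left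
      have hvE : v ∈ E ∩ R' := by rw [this]; exact hv
      exact hE'.sep.mid_right v hv' (Finset.mem_inter.1 hvE).2
    have hRE : (R ∩ E').card = 0 := by
      by_contra hc
      have := hE.sep.symm.le_corner hE'.sep hS.bound (Finset.card_ne_zero.1 hc)
      omega
    omega
  · intro x hx
    rcases hE'.sep.cover x with h | h | h
    · exact absurd h (hdisj x hx)
    · exact h
    · exact absurd ⟨x, Finset.mem_inter.2 ⟨hx, h⟩⟩ hne

/-- An end is not cut by a separator that is disjoint from it. -/
theorem TreeSetting.subset_left_or_right (hS : TreeSetting G Q k m AllSets W)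
    (hE : G.IsEnd k AllSets E T R) (h : G.IsSeparation k F S H) (hd : ∀ v ∈ E, v ∉ S) :
    E ⊆ F ∨ E ⊆ H := by
  by_cases hne : (E ∩ F).Nonempty
  · have hcells := hE.sep.card_cells h
    have hle := hE.sep.le_corner h hS.bound hne
    have hES : (E ∩ S).card = 0 := by
      rw [Finset.card_eq_zero, ← Finset.disjoint_iff_inter_eq_empty, Finset.disjoint_left]
      exact fun v => hd v
    have := hE.minimal (hE.sep.corner h hne (by omega)) trivial Finset.inter_subset_left
    exact Or.inl (Finset.inter_eq_left.1 this)
  · refine Or.inr fun v hv => ?_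
    rcases h.cover v with h | h | h
    · exact absurd ⟨v, Finset.mem_inter.2 ⟨hv, h⟩⟩ hne
    · exact absurd h (hd v hv)
    · exact h

namespace IsTriad

variable {A₁ T₁ R₁ A₂ T₂ R₂ F₁ S₁ H₁ F₂ S₂ A₃ : Finset V} {a₁ b₁ a₂ b₂ : V} {K₁ K₂ : Set V}
  (hT : IsTriad G Q k m AllSets W r A₁ T₁ R₁ a₁ b₁ K₁ A₂ T₂ R₂ a₂ b₂ K₂ F₁ S₁ H₁ F₂ S₂ A₃)
include hT

theorem left_sub_mid (hS : TreeSetting G Q k m AllSets W) : A₁ ⊆ S₁ :=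
  (hT.left.crossing hS hT.sep hT.left_mem hT.left_anchor).1

theorem right_sub_mid (hS : TreeSetting G Q k m AllSets W) : A₂ ⊆ S₂ :=
  (hT.right.crossing hS hT.isEnd.sep hT.right_mem hT.right_anchor).1

theorem mem_mid (hS : TreeSetting G Q k m AllSets W) {v : V} (hv : v ∈ S₁) :
    v ∈ A₁ ∨ v = b₁ ∨ v ∈ A₃ :=
  hT.left.mem_of_mem_mid hS hT.card_eq hT.sep hT.left_mem hT.left_anchor hT.sub hT.card.ge
    (fun v hv hv' => hT.isEnd.sep.left_right v hv (hT.left_sub hv')) (hT.anchor_notMem hS.le) hv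

/-- If A₃ ∩ R₂ is nonempty, its corner bound gives |A₃ ∩ T₂| ≥ |S₂ ∩ A₂| = m = |A₃|. -/
theorem third_sub (hS : TreeSetting G Q k m AllSets W) : A₃ ⊆ T₂ := by
  have hd : ∀ v ∈ A₃, v ∉ A₂ := fun v hv hv' =>
    hT.isEnd.sep.left_mid v hv (hT.right_sub_mid hS hv')
  by_cases hne : (A₃ ∩ R₂).Nonempty
  · have hle := hT.isEnd.sep.le_corner hT.right.isEnd.sep.symm hS.bound hne
    have hcells := hT.isEnd.sep.card_cells hT.right.isEnd.sep
    have hA₂ : (S₂ ∩ A₂).card = m := by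
      rw [Finset.inter_eq_right.2 (hT.right_sub_mid hS), hT.right.card]
    have hc := hT.card
    exact Finset.inter_eq_left.1
      (Finset.eq_of_subset_of_card_le Finset.inter_subset_left (by omega))
  · intro v hv
    rcases hT.right.isEnd.sep.cover v with h | h | h
    · exact absurd h (hd v hv)
    · exact h
    · exact absurd ⟨v, Finset.mem_inter.2 ⟨hv, h⟩⟩ hne

theorem left_notMem_right (hS : TreeSetting G Q k m AllSets W) {v : V} (hv : v ∈ A₁) : v ∉ A₂ :=
  fun hv' => hT.sep.left_mid v (hT.right_sub hv') (hT.left_sub_mid hS hv)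

theorem left_notMem_third {v : V} (hv : v ∈ A₁) : v ∉ A₃ :=
  fun hv' => hT.isEnd.sep.left_right v hv' (hT.left_sub hv)

theorem right_anchor_mem (hQ : Q ≤ G) : b₂ ∈ F₁ ∨ b₂ ∈ S₁ :=
  hT.sep.adj_left (hT.right_sub hT.right.mem) (hQ hT.right.adj)

/-- The anchored ends of a triad are not adjacent. -/
theorem left_notMem_mid (hS : TreeSetting G Q k m AllSets W) (hb : b₂ ∈ F₁) {v : V}
    (hv : v ∈ A₁) : v ∉ T₂ := by
  intro hvT
  have hm := hS.two_le
  have hk := hT.card_eq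
  have hAS := hT.left_sub_mid hS
  have hsub₁ := hS.subset_of_mem_mid hT.left.isEnd hT.right.isEnd hT.left.card.le
    (fun v hv => hT.left_notMem_right hS hv) hv hvT
  obtain ⟨a, ha, hav⟩ := hT.right.isEnd.sep.exists_adj hS.bound hvT
  have haT : a ∈ T₁ := (hT.left.isEnd.sep.adj_left hv hav.symm).resolve_left
    fun h => hT.left_notMem_right hS h ha
  have hsub₂ := hS.subset_of_mem_mid hT.right.isEnd hT.left.isEnd hT.right.card.le
    (fun v hv hv' => hT.left_notMem_right hS hv' hv) ha haT
  have hTF : T₁ ∩ F₁ = A₂ := by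
    refine (Finset.eq_of_subset_of_card_le (fun v hv =>
      Finset.mem_inter.2 ⟨hsub₂ hv, hT.right_sub hv⟩) ?_).symm
    rw [(hT.left.crossing hS hT.sep hT.left_mem hT.left_anchor).2.1, hT.right.card]
  have hbA₁ : b₂ ∉ A₁ := fun h => hT.sep.left_mid _ hb (hAS h)
  have hbA₃ : b₂ ∉ A₃ := fun h => hT.sep.left_mid _ hb (hT.sub h)
  have hT₂ : insert b₂ (A₁ ∪ A₃) = T₂ := by
    refine Finset.eq_of_subset_of_card_le (Finset.insert_subset hT.right.mem_mid
      (Finset.union_subset hsub₁ (hT.third_sub hS))) ?_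
    rw [Finset.card_insert_of_notMem (by simp [hbA₁, hbA₃]), Finset.card_union_of_disjoint,
      hT.left.card, hT.card, hT.right.isEnd.sep.card_mid]
    · omega
    · rw [Finset.disjoint_left]
      exact fun v hv => hT.left_notMem_third hv
  have hbA₂ : b₁ ∉ A₂ := fun h => hT.sep.left_mid _ (hT.right_sub h) hT.left_anchor
  -- In S₁, A₁ can be exchanged for A₂, because all neighbours of A₁ in F₁ lie in T₁ ∩ F₁ = A₂.
  have hsep : G.IsSeparation k (F₁ \ A₂) (insert b₁ (A₂ ∪ A₃)) (A₁ ∪ H₁) := by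
    refine ⟨⟨b₂, Finset.mem_sdiff.2 ⟨hb, hT.right.notMem_end⟩⟩,
      hT.left.isEnd.sep.nonempty_left.mono Finset.subset_union_left, ?_, fun v => ?_,
      fun v hv => ?_, fun v hv => ?_, fun v hv => ?_, fun u hu v hv => ?_⟩
    · rw [Finset.card_insert_of_notMem (by simp [hbA₂, hT.anchor_notMem hS.le]),
        Finset.card_union_of_disjoint, hT.right.card, hT.card]
      · omega
      · rw [Finset.disjoint_left]
        exact fun v hv hv' => hT.sep.left_mid v (hT.right_sub hv) (hT.sub hv')
    · have h1 := hT.sep.cover v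
      have h2 := fun h => hT.mem_mid hS (v := v) h
      simp only [Finset.mem_sdiff, Finset.mem_insert, Finset.mem_union]
      tauto
    · rw [Finset.mem_sdiff] at hv
      have h1 := hT.sep.left_mid v hv.1
      have h2 : v ∈ A₃ → v ∈ S₁ := fun h => hT.sub h
      have h3 : v ≠ b₁ := fun e => h1 (e ▸ hT.left_anchor)
      simp only [Finset.mem_insert, Finset.mem_union]
      tauto
    · rw [Finset.mem_sdiff] at hv
      have h1 := hT.sep.left_mid v hv.1
      have h2 := hT.sep.left_right v hv.1
      have h3 : v ∈ A₁ → v ∈ S₁ := fun h => hAS h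
      simp only [Finset.mem_union]
      tauto
    · have h1 : v ∈ A₁ → v ∈ S₁ := fun h => hAS h
      have h2 := hT.sep.mid_right v
      simp only [Finset.mem_union, Finset.mem_insert] at hv ⊢
      rcases hv with rfl | hv | hv
      · have := hT.left.notMem_end
        have := hT.left_anchor
        tauto
      · have h3 := hT.sep.left_mid v (hT.right_sub hv)
        have h4 := hT.sep.left_right v (hT.right_sub hv)
        tauto
      · have h3 := fun h => hT.left_notMem_third (v := v) h
        have h4 := hT.sub hv
        tauto
    · rw [Finset.mem_sdiff] at hu
      rcases Finset.mem_union.1 hv with hv | hv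
      · intro huv
        rcases hT.left.isEnd.sep.adj_left hv huv.symm with h | h
        · exact hT.sep.left_mid u hu.1 (hAS h)
        · exact hu.2 (hTF ▸ Finset.mem_inter.2 ⟨h, hu.1⟩)
      · exact hT.sep.not_adj u hu.1 v hv
  have hle := hS.le_card hsep trivial
  -- All outside neighbours of A₂ lie in T₂ = A₁ ∪ {b₂} ∪ A₃. So without b₂, the rest of F₁ \ A₂ is
  -- cut off by {b₁, b₂} ∪ A₃, at most m + 2 < 2m + 1 vertices as m ≥ 2.
  have hlt := hS.bound ((F₁ \ A₂).erase b₂) (insert b₁ (insert b₂ A₃)) ?_ ⟨a₁, ?_, ?_⟩ ?_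
  · have h1 := Finset.card_insert_le b₁ (insert b₂ A₃)
    have h2 := Finset.card_insert_le b₂ A₃
    have h3 := hT.card
    omega
  · rw [← Finset.card_pos]
    have := Finset.pred_card_le_card_erase (s := F₁ \ A₂) (a := b₂)
    omega
  · intro h
    exact hT.sep.left_mid a₁ (Finset.mem_sdiff.1 (Finset.mem_of_mem_erase h)).1 hT.left_mem
  · have h1 : a₁ ≠ b₁ := fun e => hT.left.notMem_end (e ▸ hT.left.mem)
    have h2 : a₁ ≠ b₂ := fun e => hbA₁ (e ▸ hT.left.mem)
    simp [h1, h2, hT.left_notMem_third hT.left.mem]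
  · intro u hu w huw
    rw [Finset.mem_erase] at hu
    have huF := (Finset.mem_sdiff.1 hu.2).1
    have hwA : w ∉ A₂ := by
      intro hw
      rcases hT.right.isEnd.sep.adj_left hw huw.symm with h | h
      · exact (Finset.mem_sdiff.1 hu.2).2 h
      · rw [← hT₂] at h
        simp only [Finset.mem_insert, Finset.mem_union] at h
        rcases h with h | h | h
        · exact hu.1 h
        · exact hT.sep.left_mid u huF (hAS h)
        · exact hT.sep.left_mid u huF (hT.sub h)
    have := hsep.adj_left hu.2 huw
    simp only [Finset.mem_insert, Finset.mem_union, Finset.mem_erase] at this ⊢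
    tauto

theorem right_notMem_mid (hS : TreeSetting G Q k m AllSets W) (hb : b₂ ∈ F₁) {v : V}
    (hv : v ∈ A₂) : v ∉ T₁ := by
  intro hvT
  obtain ⟨a, ha, hav⟩ := hT.left.isEnd.sep.exists_adj hS.bound hvT
  rcases hT.right.isEnd.sep.adj_left hv hav.symm with h | h
  · exact hT.left_notMem_right hS ha h
  · exact hT.left_notMem_mid hS hb ha h

/-- Tree edges leave the third end of a triad only towards the anchor of the second one, or
inside `W`. -/
theorem exit_eq (hS : TreeSetting G Q k m AllSets W) {u v : V} (hu : u ∈ A₃) (hv : v ∉ A₃)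
    (huv : Q.Adj u v) (hW : ¬ (u ∈ W ∧ v ∈ W)) : v = b₂ := by
  have hvS := (hT.isEnd.sep.adj_left hu (hS.le huv)).resolve_left hv
  obtain ⟨F, S, H, h, huS, hvS'⟩ := hS.exists_sep huv hW
  obtain ⟨-, -, -, hF, hH, hc⟩ := hS.end_crossing hT.isEnd h hu hvS huv hW huS hvS'
  have hvA : v ∉ A₂ := by
    intro hvA
    rcases hT.right.exitsTo.exit v hvA u huv.symm with h' | rfl
    · exact hT.isEnd.sep.left_mid u hu (hT.right_sub_mid hS h')
    · exact hT.isEnd.sep.left_mid _ hu hT.right_anchor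
  have only : ∀ w ∈ S₂, w ∈ S → w = v := fun w hw hw' => by
    have : w ∈ S₂ ∩ S := Finset.mem_inter.2 ⟨hw, hw'⟩
    rwa [hc, Finset.mem_singleton] at this
  have hd : ∀ w ∈ A₂, w ∉ S := fun w hw hwS => hvA (only w (hT.right_sub_mid hS hw) hwS ▸ hw)
  -- By cardinality A₂ fills S₂ ∩ F. The vertex b₂ is adjacent to A₂ but not in it, hence lies in S,
  -- which meets S₂ only in v.
  have key : ∀ {F H : Finset V}, G.IsSeparation k F S H → (S₂ ∩ F).card = m → A₂ ⊆ F → v = b₂ := by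
    intro F H h hF hsub
    have heq : A₂ = S₂ ∩ F := Finset.eq_of_subset_of_card_le
      (fun w hw => Finset.mem_inter.2 ⟨hT.right_sub_mid hS hw, hsub hw⟩) (by rw [hF, hT.right.card])
    rcases h.adj_left (hsub hT.right.mem) (hS.le hT.right.adj) with hb | hb
    · exact absurd (heq ▸ Finset.mem_inter.2 ⟨hT.right_anchor, hb⟩) hT.right.notMem_end
    · exact (only b₂ hT.right_anchor hb).symm
  rcases hS.subset_left_or_right hT.right.isEnd h hd with hsub | hsub
  · exact key h hF hsub
  · exact key h.symm hH hsub

omit hT in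
/-- A triad cannot occur if `W` consists of two vertices only. -/
theorem not_pair {p q : V} (hS : TreeSetting G Q k m AllSets {p, q}) (hQ : G.IsDFSTree Q r) :
    ¬ IsTriad G Q k m AllSets {p, q} r
      A₁ T₁ R₁ a₁ b₁ K₁ A₂ T₂ R₂ a₂ b₂ K₂ F₁ S₁ H₁ F₂ S₂ A₃ := by
  intro hT
  have hm := hS.two_le
  have hk := hT.card_eq
  have hb₁A := hT.anchor_notMem hS.le
  have hex := fun {F H} (h : G.IsSeparation k F S₁ H) => hT.left.exists_exit hS hT.card_eq h
    hT.left_mem hT.left_anchor hT.sub hT.card.ge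
    (fun v hv hv' => hT.isEnd.sep.left_right v hv (hT.left_sub hv')) hb₁A
  obtain ⟨u, huA, -, v, hvK, hvF, huv⟩ := hex hT.sep
  obtain ⟨u', huA', -, c, hcK, hcH, huc⟩ := hex hT.sep.symm
  have hvA : v ∉ A₃ := fun h => hT.sep.left_mid v hvF (hT.sub h)
  have hcA : c ∉ A₃ := fun h => hT.sep.mid_right c (hT.sub h) hcH
  have hvc : v ≠ c := fun e => hT.sep.left_right v hvF (e ▸ hcH)
  have hcb : c ≠ b₂ := by
    rintro rfl
    rcases hT.right_anchor_mem hS.le with h | h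
    · exact hT.sep.left_right _ h hcH
    · exact hT.sep.mid_right _ h hcH
  -- Since b₂ is not in H₁, the tree edge from A₃ into H₁ must be the exceptional one.
  have hcW : u' ∈ ({p, q} : Set V) ∧ c ∈ ({p, q} : Set V) := by
    by_contra hW
    exact hcb (hT.exit_eq hS huA' hcA huc hW)
  have hexit : ∀ x ∈ A₃, ∀ y, y ∉ A₃ → Q.Adj x y → y = b₂ ∨ y = c := by
    intro x hx y hy hxy
    by_cases hW : x ∈ ({p, q} : Set V) ∧ y ∈ ({p, q} : Set V)
    · right
      simp only [Set.mem_insert_iff, Set.mem_singleton_iff] at hW hcW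
      rcases hW with ⟨rfl | rfl, rfl | rfl⟩ <;> rcases hcW with ⟨rfl | rfl, rfl | rfl⟩ <;>
        first | rfl | contradiction
    · exact Or.inl (hT.exit_eq hS hx hy hxy hW)
  -- The edge into F₁ cannot end in c, so it ends in the anchor of A₂, which is called v from here
  -- on.
  obtain rfl : v = b₂ := (hexit u huA v hvA huv).resolve_right hvc
  have hA₃K : ∀ x ∈ A₃, x ∈ K₂ := fun x hx =>
    (hT.right.mid x (hT.third_sub hS hx)).resolve_left fun e => hvA (e ▸ hx)
  have hcK₂ : c ∈ K₂ := (hT.right.isPart.closed u' (hA₃K u' huA') c huc).resolve_right hcb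
  have hconn : Q.CutConnected (K₂ \ A₃) := by
    refine hT.right.isPart.conn.diff (c := c) fun x hxK hx y hyK hy hxy => ?_
    refine (hexit x hx y hy hxy).resolve_left ?_
    rintro rfl
    exact hT.right.isPart.notMem hyK
  have hmid : ∀ s : Finset V, s.card < k → ∃ y ∈ T₂, y ∉ s := fun s hs =>
    Finset.exists_mem_notMem_of_card_lt_card (by rwa [hT.right.isEnd.sep.card_mid])
  have hyF : ∀ y ∈ T₂, y ∈ F₁ ∨ y ∈ S₁ := by
    intro y hy
    obtain ⟨a, ha, hay⟩ := hT.right.isEnd.sep.exists_adj hS.bound hy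
    exact hT.sep.adj_left (hT.right_sub ha) hay
  -- Otherwise K₂ meets S₁ only in A₃. But K₂ \ A₃ is connected, and it contains c in H₁ as well as
  -- a vertex of T₂ in F₁.
  have hb₁K : b₁ ∈ K₂ := by
    by_contra hb₁K
    have hS₁ : ∀ x ∈ K₂, x ∈ S₁ → x ∈ A₃ := by
      intro x hxK hxS
      rcases hT.mem_mid hS hxS with h | rfl | h
      · have := hT.right.isPart.conn.subset hb₁K hT.left.exitsTo hxK h (hA₃K u huA)
        exact absurd huA (hT.left_notMem_third this)
      · exact absurd hxK hb₁K
      · exact h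
    obtain ⟨y, hyT, hy⟩ := hmid (insert v A₃) (by
      have := Finset.card_insert_le v A₃
      have := hT.card
      omega)
    rw [Finset.mem_insert, not_or] at hy
    have hyK := (hT.right.mid y hyT).resolve_left hy.1
    have hyF := (hyF y hyT).resolve_right fun h => hy.2 (hS₁ y hyK h)
    obtain ⟨x, hx, hxF, z, hz, hzF, hxz⟩ := hconn F₁ ⟨y, ⟨hyK, hy.2⟩, hyF⟩
      ⟨c, ⟨hcK₂, hcA⟩, fun h => hT.sep.left_right c h hcH⟩
    exact hz.2 (hS₁ z hz.1 ((hT.sep.adj_left hxF (hS.le hxz)).resolve_left hzF))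
  have hb₁A₂ : b₁ ∉ A₂ := hT.right.notMem b₁ hb₁K
  have hA₂K : ∀ x ∈ A₂, x ∈ K₁ := by
    by_contra! hcon
    obtain ⟨x, hxA, hxK⟩ := hcon
    obtain ⟨y, -, hy, z, -, hz, hyz⟩ := hQ.2.1.connected.preconnected.cutConnected
      {x | x ∈ A₂ ∧ x ∉ K₁} ⟨x, trivial, hxA, hxK⟩ ⟨v, trivial, fun h => h.2 hvK⟩
    have hzK : z ∈ K₁ := by
      rcases hT.right.exitsTo.exit y hy.1 z hyz with h | rfl
      · by_contra hzK
        exact hz ⟨h, hzK⟩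
      · exact hvK
    rcases hT.left.isPart.closed z hzK y hyz.symm with h | rfl
    · exact hy.2 h
    · exact hb₁A₂ hy.1
  -- K₁ is connected and contains c outside F₁, so some tree edge would leave F₁ ∩ K₂ \ A₃ within
  -- K₁. It cannot: the only neighbour of v in K₂ lies in A₃, edges from A₃ lead to v or c only, and
  -- K₁ avoids A₁ and b₁.
  have hno : ∀ z ∈ F₁, z ∈ K₂ → z ∉ A₃ → z ∉ K₁ := by
    intro z hzF hzK₂ hzA hzK₁
    obtain ⟨x, hxK₁, hx, y, hyK₁, hy, hxy⟩ := hT.left.isPart.conn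
      {x | x ∈ F₁ ∧ x ∈ K₂ ∧ x ∉ A₃} ⟨z, hzK₁, hzF, hzK₂, hzA⟩
      ⟨c, hcK, fun h => hT.sep.left_right c h.1 hcH⟩
    rcases hT.sep.adj_left hx.1 (hS.le hxy) with hyF | hyS
    · have hyA : y ∉ A₃ := fun h => hT.sep.left_mid y hyF (hT.sub h)
      have hyK₂ : y ∉ K₂ := fun h => hy ⟨hyF, h, hyA⟩
      obtain rfl := (hT.right.isPart.closed x hx.2.1 y hxy).resolve_left hyK₂
      have := hT.right.isPart.adj_unique hQ.2.1.isAcyclic hx.2.1 (hA₃K u huA) hxy.symm huv.symm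
      exact hx.2.2 (this ▸ huA)
    · rcases hT.mem_mid hS hyS with h | rfl | h
      · exact hT.left.notMem y hyK₁ h
      · exact hT.left.isPart.notMem hyK₁
      · rcases hexit y h x hx.2.2 hxy.symm with rfl | rfl
        · exact hT.right.isPart.notMem hx.2.1
        · exact hT.sep.left_right _ hx.1 hcH
  -- At most m + 2 of the 2m + 1 vertices of T₂ are excluded. The remaining y has a neighbour a in
  -- A₂ ⊆ K₁ but lies outside K₁, so the tree separates it from a at b₁.
  obtain ⟨y, hyT, hy⟩ := hmid (insert b₁ (insert v A₃)) (by
    have := Finset.card_insert_le v A₃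
    have := Finset.card_insert_le b₁ (insert v A₃)
    have := hT.card
    omega)
  simp only [Finset.mem_insert, not_or] at hy
  obtain ⟨hyb, hyv, hyA⟩ := hy
  have hyK₂ := (hT.right.mid y hyT).resolve_left hyv
  obtain ⟨a, haA, hay⟩ := hT.right.isEnd.sep.exists_adj hS.bound hyT
  have hyA₁ : y ∉ A₁ := fun h => hT.left_notMem_mid hS hvF h hyT
  have hyF₁ : y ∈ F₁ := by
    refine (hyF y hyT).resolve_right fun h => ?_
    have := hT.mem_mid hS h
    tauto
  have hyK₁ := hno y hyF₁ hyK₂ hyA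
  obtain ⟨K, hK, hyK⟩ := exists_isPart Q hyb
  have hrK : r ∉ K := by
    intro hrK
    rcases hT.left.root with h | h
    · exact hyK₁ (hT.left.isPart.eq hK h hrK ▸ hyK)
    · exact hyA₁ (hK.conn.subset hK.notMem hT.left.exitsTo hrK h.1 hyK)
  have hrK₁ : r ∈ K₁ := by
    by_contra hrK₁
    exact hQ.not_adj hT.left.isPart hK hrK₁ hrK (hA₂K a haA) hyK hyK₁ hay
  rcases hT.right.root with h | h
  -- K₁ joins a to the root without y, and K₂ joins y to the root without a, so a and y are
  -- incomparable in the tree.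
  · exact hQ.not_adj_of_avoid hT.left.isPart.conn hrK₁ (hA₂K a haA) hyK₁ hT.right.isPart.conn h
      hyK₂ (fun h => hT.right.notMem a h haA) hay
  -- Here the root lies in A₂ and K₂ contains everything outside A₂ ∪ {v}, so T₁ ∩ F₁ supplies a
  -- vertex of the kind excluded by `hno`.
  · have hc := (hT.left.crossing hS hT.sep hT.left_mem hT.left_anchor).2.1
    obtain ⟨x, hx, hxv⟩ := Finset.exists_mem_ne (s := T₁ ∩ F₁) (by omega) v
    rw [Finset.mem_inter] at hx
    have hxK₁ : x ∈ K₁ := (hT.left.mid x hx.1).resolve_left fun e =>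
      hT.sep.left_mid x hx.2 (e ▸ hT.left_anchor)
    have hxA : x ∉ A₂ := fun h => hT.right_notMem_mid hS hvF h hx.1
    have hxK₂ := ((h.2 x).resolve_left hxA).resolve_left hxv
    exact hno x hx.2 hxK₂ (fun h => hT.sep.left_mid x hx.2 (hT.sub h)) hxK₁

end IsTriad

theorem TreeSetting.not_isSeparation_of_pair {p q : V}
    (hS : TreeSetting G Q k m AllSets {p, q}) (hQ : G.IsDFSTree Q r) :
    ¬ G.IsSeparation k F S H := by
  intro h
  obtain ⟨A₁, T₁, R₁, a₁, b₁, K₁, A₂, T₂, R₂, a₂, b₂, K₂, F₁, S₁, H₁, F₂, S₂, A₃, hT⟩ :=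
    hS.exists_isTriad hQ h trivial
  exact IsTriad.not_pair hS hQ hT

end AllSeparators

/-! ### Connectivity, fragments and contraction in terms of separations -/

section Translation

variable {V : Type*} {G : SimpleGraph V} {k : ℕ}

theorem isKConnected_connectivity [Finite V] (h : G.connectivity ≠ 0) :
    G.IsKConnected G.connectivity := by
  refine Nat.sSup_mem (s := {k : ℕ | G.IsKConnected k}) ?_ ⟨Nat.card V, fun k hk => hk.1.le⟩
  by_contra hne
  rw [Set.not_nonempty_iff_eq_empty] at hne
  exact h (by simp [connectivity, hne])

theorem not_isKConnected_of_connectivity_lt [Finite V] (h : G.connectivity < k) :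
    ¬ G.IsKConnected k :=
  fun hk => h.not_ge (le_csSup ⟨Nat.card V, fun _ hk => hk.1.le⟩ hk)

theorem IsKConnected.separatorBound [DecidableEq V] (h : G.IsKConnected k) :
    G.SeparatorBound k := by
  rintro A S ⟨a, ha⟩ ⟨v, hvA, hvS⟩ hadj
  -- A and S may overlap. Only S \ A has to be removed to cut A off from v.
  refine le_trans ?_ (Finset.card_le_card (Finset.sdiff_subset (s := S) (t := A)))
  by_contra! hlt
  have hconn := h.2 ↑(S \ A) (by rwa [Set.ncard_coe_finset])
  obtain ⟨p⟩ := hconn.preconnected ⟨a, by simp [ha]⟩ ⟨v, by simp [hvS]⟩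
  obtain ⟨d, -, h1, h2⟩ := p.exists_boundary_dart (Subtype.val ⁻¹' A) ha hvA
  have hd := d.snd.2
  simp only [Finset.coe_sdiff, Set.mem_compl_iff, Set.mem_sdiff, Finset.mem_coe] at hd
  exact hd ⟨(hadj d.fst h1 d.snd d.adj).resolve_left h2, h2⟩

theorem exists_isSeparation [Fintype V] [DecidableEq V] {T : Finset V} (hT : T.card = k)
    (hk : k < Nat.card V) (h : ¬ (G.induce (↑T)ᶜ).Connected) :
    ∃ F R, G.IsSeparation k F T R := by
  classical
  obtain ⟨z, -, hz⟩ : ∃ z ∈ Finset.univ, z ∉ T :=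
    Finset.exists_mem_notMem_of_card_lt_card (by rwa [hT, Finset.card_univ, ← Nat.card_eq_fintype_card])
  have hne : Nonempty ↥((↑T : Set V)ᶜ) := ⟨⟨z, hz⟩⟩
  have hpre : ¬ (G.induce (↑T)ᶜ).Preconnected := fun hp => h ⟨hp⟩
  simp only [Preconnected, not_forall] at hpre
  obtain ⟨x, y, hxy⟩ := hpre
  let D : Set V := {v | ∃ w : ↥((↑T : Set V)ᶜ), w.1 = v ∧ (G.induce (↑T)ᶜ).Reachable x w}
  have hDT : ∀ v ∈ D, v ∉ T := by
    rintro _ ⟨w, rfl, -⟩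
    exact w.2
  refine ⟨Finset.univ.filter (· ∈ D), Finset.univ.filter fun v => v ∉ D ∧ v ∉ T,
    ⟨x, by simpa using ⟨x, rfl, Reachable.refl x⟩⟩, ⟨y, ?_⟩, hT, fun v => ?_, fun v hv => ?_,
    fun v hv => ?_, fun v hv => ?_, fun u hu v hv huv => ?_⟩
  · simp only [Finset.mem_filter, Finset.mem_univ, true_and]
    refine ⟨?_, y.2⟩
    rintro ⟨w, hw, hxw⟩
    rw [Subtype.val_inj] at hw
    exact hxy (hw ▸ hxw)
  · simp only [Finset.mem_filter, Finset.mem_univ, true_and]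
    tauto
  · simp only [Finset.mem_filter, Finset.mem_univ, true_and] at hv
    exact hDT v hv
  · simp only [Finset.mem_filter, Finset.mem_univ, true_and] at hv ⊢
    tauto
  · simp only [Finset.mem_filter, Finset.mem_univ, true_and]
    tauto
  · simp only [Finset.mem_filter, Finset.mem_univ, true_and] at hu hv
    obtain ⟨w, rfl, hw⟩ := hu
    have hwv : (G.induce (↑T)ᶜ).Adj w ⟨v, hv.2⟩ := huv
    exact hv.1 ⟨⟨v, hv.2⟩, rfl, hw.trans hwv.reachable⟩

theorem IsSeparation.mem_left_of_reachable {F T R : Finset V} (h : G.IsSeparation k F T R)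
    {x y : ↥((↑T : Set V)ᶜ)} (hxy : (G.induce (↑T)ᶜ).Reachable x y) (hx : x.1 ∈ F) : y.1 ∈ F := by
  by_contra hy
  obtain ⟨p⟩ := hxy
  obtain ⟨d, -, h1, h2⟩ := p.exists_boundary_dart (Subtype.val ⁻¹' F) hx hy
  have h3 := (h.cover d.snd.1).resolve_left h2
  exact h.not_adj d.fst h1 d.snd (h3.resolve_left d.snd.2) d.adj

theorem IsSeparation.isFragmentOf {F T R : Finset V}
    (h : G.IsSeparation G.connectivity F T R) : G.IsFragmentOf ↑T ↑F := by
  obtain ⟨x, hx⟩ := h.nonempty_left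
  obtain ⟨y, hy⟩ := h.nonempty_right
  have hxT := h.left_mid x hx
  have hyT : y ∉ T := fun hT => h.mid_right y hT hy
  have hyF : y ∉ F := fun hF => h.left_right y hF hy
  refine ⟨⟨by rw [Set.ncard_coe_finset, h.card_mid], fun hc => ?_⟩,
    {c | ∃ w : ↥((↑T : Set V)ᶜ), w.1 ∈ F ∧ (G.induce (↑T)ᶜ).connectedComponentMk w = c},
    ⟨_, ⟨x, hxT⟩, hx, rfl⟩, fun huniv => ?_, ?_⟩
  · exact hyF (h.mem_left_of_reachable (hc.preconnected ⟨x, hxT⟩ ⟨y, hyT⟩) hx)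
  · have hmem : (G.induce (↑T)ᶜ).connectedComponentMk ⟨y, hyT⟩ ∈ Set.univ := trivial
    rw [← huniv] at hmem
    obtain ⟨w, hw, hwy⟩ := hmem
    exact hyF (h.mem_left_of_reachable (ConnectedComponent.exact hwy) hw)
  · ext v
    simp only [Set.mem_image, Set.mem_iUnion, Finset.mem_coe]
    constructor
    · intro hv
      exact ⟨⟨v, h.left_mid v hv⟩, ⟨_, ⟨⟨v, h.left_mid v hv⟩, hv, rfl⟩, rfl⟩, rfl⟩
    · rintro ⟨w, ⟨c, ⟨z, hz, rfl⟩, hw⟩, rfl⟩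
      exact h.mem_left_of_reachable (ConnectedComponent.exact hw.symm) hz

/-- Walks avoiding the preimage of `T` project to walks avoiding `T`. So a separator of `G/e` pulls
back to one of `G`. -/
theorem Connected.contractEdge_induce {e : Sym2 V} {T : Set (Quotient (identifyEnds e))}
    (h : (G.induce (Quotient.mk (identifyEnds e) ⁻¹' T)ᶜ).Connected) :
    ((G.contractEdge e).induce Tᶜ).Connected := by
  have key : ∀ x y : ↥(Quotient.mk (identifyEnds e) ⁻¹' T)ᶜ,
      ((G.contractEdge e).induce Tᶜ).Reachable ⟨Quotient.mk _ x.1, x.2⟩ ⟨Quotient.mk _ y.1, y.2⟩ := by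
    intro x y
    obtain ⟨p⟩ := h.preconnected x y
    induction p with
    | nil => exact Reachable.refl _
    | @cons u v w huv _ ih =>
      refine Reachable.trans ?_ ih
      by_cases heq : (Quotient.mk (identifyEnds e) u.1) = Quotient.mk _ v.1
      · simp only [heq]
        exact Reachable.refl _
      · refine Adj.reachable ?_
        exact ⟨heq, u.1, v.1, rfl, rfl, huv⟩
  obtain ⟨z⟩ := h.nonempty
  have : Nonempty ↥Tᶜ := ⟨⟨Quotient.mk _ z.1, z.2⟩⟩
  refine ⟨?_⟩
  rintro ⟨p, hp⟩ ⟨q, hq⟩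
  induction p using Quotient.inductionOn with
  | _ x =>
    induction q using Quotient.inductionOn with
    | _ y => exact key ⟨x, hp⟩ ⟨y, hq⟩

theorem injOn_mk_identifyEnds (x y : V) :
    Set.InjOn (Quotient.mk (identifyEnds s(x, y))) {y}ᶜ := by
  intro u hu v hv huv
  rcases Quotient.exact huv with h | ⟨h1, h2⟩
  · exact h
  · rw [Sym2.mem_iff] at h1 h2
    rw [h1.resolve_right hu, h2.resolve_right hv]

/-- An edge that is not contractible lies in a smallest separator. -/
theorem exists_isSeparation_of_not_isKContractible [Fintype V] [DecidableEq V]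
    (hG : G.IsKConnected k) (hcard : k + 2 ≤ Nat.card V) {x y : V} (hxy : G.Adj x y)
    (h : ¬ G.IsKContractible k s(x, y)) : ∃ F T R, G.IsSeparation k F T R ∧ x ∈ T ∧ y ∈ T := by
  classical
  have hquot : k < Nat.card (Quotient (identifyEnds s(x, y))) := by
    have h1 : ({y}ᶜ : Set V).ncard ≤ (Set.univ : Set (Quotient (identifyEnds s(x, y)))).ncard :=
      Set.ncard_le_ncard_of_injOn _ (fun _ _ => trivial) (injOn_mk_identifyEnds x y)
        (Set.toFinite _)
    have h2 := Set.ncard_add_ncard_compl ({y} : Set V)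
    rw [Set.ncard_univ] at h1
    rw [Set.ncard_singleton] at h2
    omega
  have hnot : ¬ (G.contractEdge s(x, y)).IsKConnected k := fun hc => h ⟨hxy, hc⟩
  simp only [IsKConnected, hquot, true_and, not_forall] at hnot
  obtain ⟨T', hT', hconn⟩ := hnot
  set T : Set V := Quotient.mk (identifyEnds s(x, y)) ⁻¹' T' with hTdef
  have hTconn : ¬ (G.induce Tᶜ).Connected := fun hc => hconn hc.contractEdge_induce
  -- T separates `G`, so it has at least k vertices, while T' has fewer than k and the projection is
  -- injective away from y. Hence T contains both ends of the edge and has exactly k vertices.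
  have hle : k ≤ T.ncard := by
    by_contra! hlt
    exact hTconn (hG.2 T hlt)
  have hdiff : (T \ {y}).ncard ≤ T'.ncard :=
    Set.ncard_le_ncard_of_injOn _ (fun v hv => hv.1)
      ((injOn_mk_identifyEnds x y).mono fun v hv => hv.2) (Set.toFinite _)
  have hyT : y ∈ T := by
    by_contra hy
    rw [Set.sdiff_singleton_eq_self hy] at hdiff
    omega
  have hxT : x ∈ T := by
    have hq : (Quotient.mk (identifyEnds s(x, y)) x) = Quotient.mk _ y :=
      Quotient.sound (Or.inr ⟨Sym2.mem_mk_left x y, Sym2.mem_mk_right x y⟩)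
    rw [hTdef, Set.mem_preimage] at hyT ⊢
    rwa [hq]
  have hcardT := Set.ncard_sdiff_singleton_add_one hyT (Set.toFinite T)
  have hTk : T.toFinset.card = k := by
    rw [← Set.ncard_eq_toFinset_card']
    omega
  obtain ⟨F, R, hsep⟩ := exists_isSeparation hTk (by omega)
    (by rwa [Set.coe_toFinset])
  exact ⟨F, T.toFinset, R, hsep, by simpa using hxT, by simpa using hyT⟩

theorem IsKConnected.add_two_le_card [Fintype V] [DecidableEq V] (hG : G.IsKConnected k)
    (hne : G ≠ ⊤) : k + 2 ≤ Nat.card V := by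
  obtain ⟨u, v, huv, hadj⟩ : ∃ u v, u ≠ v ∧ ¬ G.Adj u v := by
    by_contra! hcon
    exact hne (eq_top_iff.2 fun u v huv => hcon u v huv)
  have hb := hG.separatorBound {u} (Finset.univ \ {u, v}) ⟨u, by simp⟩
    ⟨v, by simp [huv.symm], by simp⟩ ?_
  · rw [Finset.card_sdiff_of_subset (Finset.subset_univ _), Finset.card_pair huv, Finset.card_univ,
      ← Nat.card_eq_fintype_card] at hb
    have := hG.1
    by_contra hlt
    have h2 : 2 ≤ Nat.card V := by
      rw [Nat.card_eq_fintype_card, ← Finset.card_pair huv]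
      exact Finset.card_le_univ _
    omega
  · rintro w hw z hwz
    rw [Finset.mem_singleton] at hw
    subst hw
    right
    have h1 : z ≠ w := hwz.ne'
    have h2 : z ≠ v := fun e => hadj (e ▸ hwz)
    simp [h1, h2]

end Translation

end SimpleGraph

/-! ### The theorem -/

open SimpleGraph

theorem theorem7 {V : Type*} [Finite V] (G Q : SimpleGraph V) (r : V) (k : ℕ)
    (hQ : G.IsDFSTree Q r) (hG : G ≠ ⊤) (hκ : G.connectivity = k) (hk : 3 < k) :
    ((∀ F : Set V, G.IsFragmentWrt Q.edgeVertexSets F → ((k : ℝ) - 1) / 2 ≤ (F.ncard : ℝ)) →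
      ∃ e ∈ Q.edgeSet, G.IsKContractible k e) ∧
    ((∀ F : Set V, G.IsFragment F → ((k : ℝ) - 1) / 2 ≤ (F.ncard : ℝ)) →
      ∃ e ∈ Q.edgeSet, ∃ e' ∈ Q.edgeSet, e ≠ e' ∧
        G.IsKContractible k e ∧ G.IsKContractible k e') := by
  classical
  have := Fintype.ofFinite V
  subst hκ
  have hconn : G.IsKConnected G.connectivity := isKConnected_connectivity (by omega)
  have hcard := hconn.add_two_le_card hG
  have hbound := hconn.separatorBound
  -- The bound (k - 1)/2 ≤ |F| means k ≤ 2|F| + 1, that is ⌊k/2⌋ ≤ |F|. So m = ⌊k/2⌋ serves both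
  -- parities, and k > 3 gives m ≥ 2.
  have hhalf : ∀ F : Finset V, ((G.connectivity : ℝ) - 1) / 2 ≤ ((F : Set V).ncard : ℝ) →
      G.connectivity / 2 ≤ F.card := by
    intro F hF
    rw [Set.ncard_coe_finset] at hF
    have : (G.connectivity : ℝ) ≤ ((2 * F.card + 1 : ℕ) : ℝ) := by
      push_cast
      linarith
    have := Nat.cast_le.1 this
    omega
  obtain ⟨p, q, hpq⟩ : ∃ p q, Q.Adj p q := by
    obtain ⟨u, hu⟩ : ∃ u, u ≠ r := by
      have : 1 < Fintype.card V := by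
        rw [← Nat.card_eq_fintype_card]
        omega
      exact Fintype.exists_ne_of_one_lt_card this r
    obtain ⟨p, -, -, q, -, -, hpq⟩ := hQ.2.1.connected.preconnected.cutConnected {r}
      ⟨r, trivial, rfl⟩ ⟨u, trivial, hu⟩
    exact ⟨p, q, hpq⟩
  have first : (∀ F : Set V, G.IsFragmentWrt Q.edgeVertexSets F →
      ((G.connectivity : ℝ) - 1) / 2 ≤ (F.ncard : ℝ)) →
      ∃ e ∈ Q.edgeSet, G.IsKContractible G.connectivity e := by
    intro hF
    by_contra! hcon
    have hsep : ∀ {u v}, Q.Adj u v →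
        ∃ F T R, G.IsSeparation G.connectivity F T R ∧ u ∈ T ∧ v ∈ T := fun huv =>
      exists_isSeparation_of_not_isKContractible hconn hcard (hQ.1 huv) (hcon _ huv)
    -- The family consists of the sets containing both ends of a tree edge, so its fragments are the
    -- `𝔖`-fragments.
    have hS : TreeSetting G Q G.connectivity (G.connectivity / 2)
        (fun T => ∃ u v, Q.Adj u v ∧ u ∈ T ∧ v ∈ T) ∅ := by
      refine ⟨hQ.1, hbound, by omega, by omega, by omega, ?_, ?_, fun huv _ => hsep huv, ?_⟩
      · rintro F T R h ⟨u, v, huv, hu, hv⟩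
        refine hhalf F (hF F ⟨T, h.isFragmentOf, {w | w ∈ s(u, v)}, ⟨s(u, v), huv, rfl⟩, ?_⟩)
        intro w hw
        rcases Sym2.mem_iff.1 hw with rfl | rfl <;> assumption
      · exact fun _ huv _ hu hv => ⟨_, _, huv, hu, hv⟩
      · exact fun u hu => absurd hu (Set.notMem_empty u)
    obtain ⟨F, T, R, h, hp, hq⟩ := hsep hpq
    exact hS.not_of_empty hQ h ⟨p, q, hpq, hp, hq⟩
  refine ⟨first, fun hF => ?_⟩
  by_contra! hcon
  obtain ⟨e, heQ, he⟩ := first fun F ⟨T, hT, _⟩ => hF F ⟨T, hT⟩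
  induction e using Sym2.ind with
  | _ a b =>
    have hS : TreeSetting G Q G.connectivity (G.connectivity / 2) AllSets {a, b} := by
      refine ⟨hQ.1, hbound, by omega, by omega, by omega, ?_, ?_, ?_, ?_⟩
      · exact fun h _ => hhalf _ (hF _ ⟨_, h.isFragmentOf⟩)
      · exact fun _ _ _ _ _ => trivial
      · intro u v huv hW
        refine exists_isSeparation_of_not_isKContractible hconn hcard (hQ.1 huv)
          (hcon _ heQ _ huv ?_ he)
        intro heq
        refine hW ⟨?_, ?_⟩
        · simpa using (heq ▸ Sym2.mem_mk_left u v : u ∈ s(a, b))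
        · simpa using (heq ▸ Sym2.mem_mk_right u v : v ∈ s(a, b))
      · have hab : G.Adj a b := hQ.1 heQ
        rintro u (rfl | rfl) v (rfl | rfl) huv
        · exact absurd rfl huv
        · exact hab
        · exact hab.symm
        · exact absurd rfl huv
    -- A smallest separator comes from the failure of (k + 1)-connectivity, which is not due to a
    -- lack of vertices because |V| ≥ k + 2.
    have hnot := not_isKConnected_of_connectivity_lt (G := G) (Nat.lt_succ_self _)
    have hlt : G.connectivity.succ < Nat.card V := by omega
    simp only [IsKConnected, hlt, true_and, not_forall] at hnot
    obtain ⟨T, hT, hTc⟩ := hnot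
    have hle : G.connectivity ≤ T.ncard := by
      by_contra! hlt
      exact hTc (hconn.2 T hlt)
    obtain ⟨F, R, h⟩ := exists_isSeparation (G := G) (T := T.toFinset) (k := G.connectivity)
      (by rw [← Set.ncard_eq_toFinset_card']; omega) (by omega) (by rwa [Set.coe_toFinset])
    exact hS.not_isSeparation_of_pair hQ h
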